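/- Let $q=e^{\hbar}$ with $\hbar\in\mathbb C$ and $0<|q|<1$, and write $q^{z}=e^{\hbar z}$ for numbers and operators $z$, $[z]_q=\frac{q^z-q^{-z}}{q-q^{-1}}$, $(z)_q=q^{z-1}[z]_q$, $[n]_q!=[n]_q\cdots[1]_q$, $(n)_q!=(n)_q\cdots(1)_q$, $\exp_q(z)=\sum_{n\ge0}\frac{z^n}{(n)_q!}$. Let $V$ be a finite-dimensional representation of $U_q(sl(2))$, that is, a finite-dimensional complex vector space with operators $h,E_+,E_-$ satisfying $[h,E_\pm]=\pm2E_\pm$ and $[E_+,E_-]=[h]_q$, and put $e=q^{h/2}E_+$, $f=E_-q^{-h/2}$. For $x\in\mathbb C^*$ consider the following operators on $V$: Babelon's element $$M(x)=\sum_{n,m\ge0}\frac{(-1)^m x^m q^{n(n-1)/2+m(n-m)}}{[m]_q!\,[n]_q!\,\prod_{p=1}^{n}(xq^p-x^{-1}q^{-p})}\,E_+^nE_-^m\,q^{(n+m)h/2},$$ the infinite product $N(x)=N_-(x)N_+(x)$ with $$N_+(x)=\exp_{q^{-1}}(-xe),\qquad N_-(x)=\prod_{k=+\infty}^{0}\exp_{q^{-1}}\bigl(q^{-(2k+1)(h+1)}x^{-2k-1}f\bigr)$$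 (factors with larger $k$ stand further to the left), and $$(q^2x^2;q^2)_h=\frac{(q^2x^2;q^2)_\infty}{(q^{2}x^2q^{2h};q^2)_\infty},\qquad (a;p)_\infty=\prod_{i\ge0}(1-p^ia).$$ Suppose that $x^2q^{2j}\ne1$ for all integers $j\ge1$ (so that all the denominators of $M(x)$ are non-zero), and that $x$ is large relative to $V$ in the sense that $|xq^{\mu+1}|>1$ whenever $\mu$ and $\mu+2$ are both eigenvalues of $h$ on $V$ (this excludes only a bounded set of $x$). Then on $V$ all the above series and infinite products converge, the operator $(q^2x^2q^{2h};q^2)_\infty$ is invertible, and $$N(x)=(q^2x^2;q^2)_h\,M(x).$$ -/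

import Mathlib

open Filter Topology

noncomputable section

namespace UqSl2

/- Throughout, `q = exp ℏ` and `q ^ z = exp (ℏ z)`, for numbers and for operators `z`; the base
`q⁻¹` is obtained by replacing `ℏ` with `-ℏ`. -/

/-- `q ^ z` for a complex number `z`. -/
def cpow (ℏ z : ℂ) : ℂ := Complex.exp (ℏ * z)

/-- `[z]_q = (q ^ z - q ^ (-z)) / (q - q⁻¹)`. -/
def qNum (ℏ z : ℂ) : ℂ := (cpow ℏ z - cpow ℏ (-z)) / (cpow ℏ 1 - cpow ℏ (-1))

/-- `[n]_q! = [n]_q ⋯ [1]_q`. -/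
def qFact (ℏ : ℂ) (n : ℕ) : ℂ := ∏ k ∈ Finset.range n, qNum ℏ ((k : ℂ) + 1)

/-- `(z)_q = q ^ (z - 1) [z]_q`. -/
def pNum (ℏ z : ℂ) : ℂ := cpow ℏ (z - 1) * qNum ℏ z

/-- `(n)_q! = (n)_q ⋯ (1)_q`. -/
def pFact (ℏ : ℂ) (n : ℕ) : ℂ := ∏ k ∈ Finset.range n, pNum ℏ ((k : ℂ) + 1)

section Operators

variable {V : Type*} [NormedAddCommGroup V] [NormedSpace ℂ V]

/-- `q ^ T` for an operator `T`. -/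
def opPow (ℏ : ℂ) (T : V →L[ℂ] V) : V →L[ℂ] V := NormedSpace.exp (ℏ • T)

/-- `[T]_q` for an operator `T`. -/
def opNum (ℏ : ℂ) (T : V →L[ℂ] V) : V →L[ℂ] V :=
  (cpow ℏ 1 - cpow ℏ (-1))⁻¹ • (opPow ℏ T - opPow ℏ (-T))

/-- The `n`-th term `T ^ n / (n)_q!` of the `q`-exponential of `T`. -/
def qExpTerm (ℏ : ℂ) (T : V →L[ℂ] V) (n : ℕ) : V →L[ℂ] V := (pFact ℏ n)⁻¹ • T ^ n

/-- The `q`-exponential `exp_q(T) = ∑ T ^ n / (n)_q!`. -/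
def qExp (ℏ : ℂ) (T : V →L[ℂ] V) : V →L[ℂ] V := ∑' n, qExpTerm ℏ T n

/-- The finite product `(A; p)_K = (1 - A) (1 - p A) ⋯ (1 - p ^ (K - 1) A)`. -/
def qPochPartial (p : ℂ) (A : V →L[ℂ] V) : ℕ → (V →L[ℂ] V)
  | 0 => 1
  | K + 1 => qPochPartial p A K * (1 - p ^ K • A)

/-- The infinite product `(A; p)_∞`. -/
def qPochInf (p : ℂ) (A : V →L[ℂ] V) : V →L[ℂ] V := limUnder atTop (qPochPartial p A)

end Operators

/-- A representation of `U_q(sl(2))` on `V`: operators satisfying the defining relations. -/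
structure Rep (ℏ : ℂ) (V : Type*) [NormedAddCommGroup V] [NormedSpace ℂ V] where
  /-- The Cartan generator. -/
  h : V →L[ℂ] V
  /-- The generator `E_+`. -/
  Ep : V →L[ℂ] V
  /-- The generator `E_-`. -/
  Em : V →L[ℂ] V
  h_Ep : h * Ep - Ep * h = (2 : ℂ) • Ep
  h_Em : h * Em - Em * h = (-2 : ℂ) • Em
  Ep_Em : Ep * Em - Em * Ep = opNum ℏ h

namespace Rep

variable {ℏ : ℂ} {V : Type*} [NormedAddCommGroup V] [NormedSpace ℂ V] (ρ : Rep ℏ V)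

/-- `e = q ^ (h / 2) E_+`. -/
def e : V →L[ℂ] V := opPow ℏ ((1 / 2 : ℂ) • ρ.h) * ρ.Ep

/-- `f = E_- q ^ (-h / 2)`. -/
def f : V →L[ℂ] V := ρ.Em * opPow ℏ ((-1 / 2 : ℂ) • ρ.h)

/-- `N_+(x) = exp_{q⁻¹}(-x e)`. -/
def Nplus (x : ℂ) : V →L[ℂ] V := qExp (-ℏ) (-x • ρ.e)

/-- The argument `q ^ (-(2k+1)(h+1)) x ^ (-2k-1) f` of the `k`-th factor of `N_-(x)`. -/
def NminusArg (x : ℂ) (k : ℕ) : V →L[ℂ] V :=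
  (x ^ (2 * k + 1))⁻¹ • (opPow ℏ ((-(2 * (k : ℂ) + 1)) • (ρ.h + 1)) * ρ.f)

/-- The partial products of `N_-(x)`: factors with larger `k` stand further to the left. -/
def NminusPartial (x : ℂ) : ℕ → (V →L[ℂ] V)
  | 0 => 1
  | K + 1 => qExp (-ℏ) (ρ.NminusArg x K) * NminusPartial x K

/-- `N_-(x) = ∏_{k = ∞}^{0} exp_{q⁻¹}(q ^ (-(2k+1)(h+1)) x ^ (-2k-1) f)`. -/
def Nminus (x : ℂ) : V →L[ℂ] V := limUnder atTop (ρ.NminusPartial x)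

/-- `N(x) = N_-(x) N_+(x)`. -/
def N (x : ℂ) : V →L[ℂ] V := ρ.Nminus x * ρ.Nplus x

/-- The `(n, m)` term of Babelon's double series. -/
def MTerm (x : ℂ) (nm : ℕ × ℕ) : V →L[ℂ] V :=
  (((-1) ^ nm.2 * x ^ nm.2 *
      cpow ℏ ((nm.1 : ℂ) * ((nm.1 : ℂ) - 1) / 2 + (nm.2 : ℂ) * ((nm.1 : ℂ) - (nm.2 : ℂ)))) /
    (qFact ℏ nm.2 * qFact ℏ nm.1 *
      ∏ p ∈ Finset.Icc 1 nm.1, (x * cpow ℏ (p : ℂ) - x⁻¹ * cpow ℏ (-(p : ℂ))))) •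
  (ρ.Ep ^ nm.1 * ρ.Em ^ nm.2 * opPow ℏ ((((nm.1 : ℂ) + (nm.2 : ℂ)) / 2) • ρ.h))

/-- Babelon's element `M(x)`. -/
def M (x : ℂ) : V →L[ℂ] V := ∑' nm : ℕ × ℕ, ρ.MTerm x nm

/-- The operator `q² x² q ^ (2h)`. -/
def shiftedArg (x : ℂ) : V →L[ℂ] V := (cpow ℏ 2 * x ^ 2) • opPow ℏ ((2 : ℂ) • ρ.h)

/-- `(q² x²; q²)_h = (q² x²; q²)_∞ / (q² x² q ^ (2h); q²)_∞`. -/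
def dynFactor (x : ℂ) : V →L[ℂ] V :=
  qPochInf (cpow ℏ 2) ((cpow ℏ 2 * x ^ 2) • (1 : V →L[ℂ] V)) *
    Ring.inverse (qPochInf (cpow ℏ 2) (ρ.shiftedArg x))

end Rep

end UqSl2

end

set_option linter.unusedSectionVars false

/-! Write `Q = q²` and `W = q² x² q^(2h)`. After multiplication by the Pochhammer denominators the
claim reads `(W; Q)_∞ N(x) = (q² x²; Q)_∞ M(x)`, and both sides equal the same normally ordered
series, with terms `(-x)^(a+b) q^(ab) / ([a]! [b]!) (Q^a W; Q)_∞ q^((a+b)h/2) E_-^a E_+^b`.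

For `M`, every `E_+^n E_-^m` is rewritten in the monomials `E_-^a E_+^b` with coefficients in the
Cartan part (`Ep_pow_mul_Em_pow`). A fixed pair `(a, b)` receives contributions from all `(n, m) =
(b+k, a+k)`, and these form a basic hypergeometric series `₁φ₁` in `k`. Its sum is a quotient of
infinite products (`qPochInf_mul_tsum_phiTerm`), which gives `qPochInf_mul_M`.

For `N`, put `G(Z) = ∑ lowerTerm ℏ W Z n`. The arguments `Z_k` of the factors of `N_-` satisfy
`Z_(k+1) = W⁻¹ Z_k`, and a finite q-identity (`sum_antidiagonal_qPochInf`) yields `G(Z_k) =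
G(Z_(k+1)) exp_{q⁻¹}(Z_k)`. Iterating, with `Z_k → 0` and `G(0) = (W; Q)_∞`, gives `(W; Q)_∞ N_- =
G(Z_0)`; multiplying by `N_+` gives `qPochInf_mul_N`.

Two analytic facts remain. The product `N_-` converges because the `Z_k` are built from powers of
`(xq)⁻¹ q^(-h)` acting on the range of `E_-`, where largeness of `x` puts all its eigenvalues inside
the unit disc (`summable_norm_NminusArg`). The operator `(W; Q)_∞` is invertible because a weight
string through any eigenvector of `h` forces `q^(2μ)` to be an integral power of `Q`, so that a zero
factor would contradict either regularity or largeness of `x` (`one_sub_ne_zero_of_hasEigenvalue`).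
-/

noncomputable section

namespace UqSl2

/-! ### Powers of `q`, q-numbers and q-factorials. -/

section Scalars

variable (ℏ : ℂ)

theorem cpow_add (a b : ℂ) : cpow ℏ (a + b) = cpow ℏ a * cpow ℏ b := by
  simp only [cpow, mul_add, Complex.exp_add]

theorem cpow_sub (a b : ℂ) : cpow ℏ (a - b) = cpow ℏ a / cpow ℏ b := by
  simp only [cpow, mul_sub, Complex.exp_sub]

@[simp] theorem cpow_zero : cpow ℏ 0 = 1 := by simp [cpow]

theorem cpow_neg (a : ℂ) : cpow ℏ (-a) = (cpow ℏ a)⁻¹ := by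
  simp only [cpow, mul_neg, Complex.exp_neg]

@[simp] theorem cpow_ne_zero (a : ℂ) : cpow ℏ a ≠ 0 := Complex.exp_ne_zero _

theorem cpow_nat_mul (n : ℕ) (a : ℂ) : cpow ℏ (n * a) = cpow ℏ a ^ n := by
  simp only [cpow, ← Complex.exp_nat_mul]
  ring_nf

theorem cpow_nat (n : ℕ) : cpow ℏ n = cpow ℏ 1 ^ n := by
  simpa using cpow_nat_mul ℏ n 1

theorem cpow_base_neg (a : ℂ) : cpow (-ℏ) a = cpow ℏ (-a) := by simp [cpow]

theorem cpow_two : cpow ℏ 2 = cpow ℏ 1 ^ 2 := by simpa using cpow_nat ℏ 2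

theorem qNum_base_neg (z : ℂ) : qNum (-ℏ) z = qNum ℏ z := by
  simp only [qNum, cpow_base_neg, neg_neg]
  rw [← neg_div_neg_eq, neg_sub, neg_sub]

@[simp] theorem qNum_zero : qNum ℏ 0 = 0 := by simp [qNum]

theorem qFact_succ (n : ℕ) : qFact ℏ (n + 1) = qFact ℏ n * qNum ℏ (n + 1) := by
  simp [qFact, Finset.prod_range_succ]

theorem pFact_succ (n : ℕ) : pFact ℏ (n + 1) = pFact ℏ n * pNum ℏ (n + 1) := by
  simp [pFact, Finset.prod_range_succ]

@[simp] theorem qFact_zero : qFact ℏ 0 = 1 := by simp [qFact]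

@[simp] theorem pFact_zero : pFact ℏ 0 = 1 := by simp [pFact]

theorem pFact_eq (n : ℕ) :
    pFact ℏ n = cpow ℏ ((n : ℂ) * ((n : ℂ) - 1) / 2) * qFact ℏ n := by
  induction n with
  | zero => simp
  | succ n ih =>
    rw [pFact_succ, qFact_succ, ih, pNum]
    have : cpow ℏ (((n + 1 : ℕ) : ℂ) * (((n + 1 : ℕ) : ℂ) - 1) / 2)
        = cpow ℏ ((n : ℂ) * ((n : ℂ) - 1) / 2) * cpow ℏ ((n : ℂ) + 1 - 1) := by
      rw [← cpow_add]; congr 1; push_cast; ring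
    rw [this]; ring

theorem qFact_base_neg (n : ℕ) : qFact (-ℏ) n = qFact ℏ n := by
  simp only [qFact, qNum_base_neg]

theorem pNum_add (a b : ℂ) : pNum ℏ (a + b) = pNum ℏ b + cpow ℏ (2 * b) * pNum ℏ a := by
  simp only [pNum, qNum, two_mul, cpow_add, cpow_sub, cpow_neg, mul_inv]
  have ha := cpow_ne_zero ℏ a
  have hb := cpow_ne_zero ℏ b
  have h1 := cpow_ne_zero ℏ 1
  rw [← mul_div_assoc, ← mul_div_assoc, ← mul_div_assoc, ← mul_div_assoc, ← add_div]
  congr 1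
  field_simp
  ring

variable {ℏ}

theorem cpow_one_pow_ne_one (hℏ : ‖cpow ℏ 1‖ < 1) {n : ℕ} (hn : n ≠ 0) : cpow ℏ 1 ^ n ≠ 1 := by
  intro h
  have h1 : ‖cpow ℏ 1‖ ^ n < 1 := pow_lt_one₀ (norm_nonneg _) hℏ hn
  rw [← norm_pow, h] at h1
  simp at h1

theorem cpow_one_sub_ne_zero (hℏ : ‖cpow ℏ 1‖ < 1) : cpow ℏ 1 - cpow ℏ (-1) ≠ 0 := by
  intro h
  rw [sub_eq_zero, cpow_neg, ← mul_left_inj' (cpow_ne_zero ℏ 1),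
    inv_mul_cancel₀ (cpow_ne_zero ℏ 1), ← sq] at h
  exact cpow_one_pow_ne_one hℏ two_ne_zero h

theorem norm_cpow_two_lt_one (hℏ : ‖cpow ℏ 1‖ < 1) : ‖cpow ℏ 2‖ < 1 := by
  rw [cpow_two, norm_pow]
  exact pow_lt_one₀ (norm_nonneg _) hℏ two_ne_zero

theorem qNum_eq_zero_iff (hℏ : ‖cpow ℏ 1‖ < 1) (z : ℂ) : qNum ℏ z = 0 ↔ cpow ℏ (2 * z) = 1 := by
  rw [qNum, div_eq_zero_iff, or_iff_left (cpow_one_sub_ne_zero hℏ), sub_eq_zero, cpow_neg,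
    ← mul_left_inj' (cpow_ne_zero ℏ z), inv_mul_cancel₀ (cpow_ne_zero ℏ z), two_mul, cpow_add]

theorem qNum_nat_ne_zero (hℏ : ‖cpow ℏ 1‖ < 1) (n : ℕ) : qNum ℏ ((n : ℂ) + 1) ≠ 0 := by
  rw [Ne, qNum_eq_zero_iff hℏ]
  have : cpow ℏ (2 * ((n : ℂ) + 1)) = cpow ℏ 1 ^ (2 * (n + 1)) := by
    rw [← cpow_nat]; push_cast; rfl
  rw [this]
  exact cpow_one_pow_ne_one hℏ (by omega)

theorem qFact_ne_zero (hℏ : ‖cpow ℏ 1‖ < 1) (n : ℕ) : qFact ℏ n ≠ 0 :=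
  Finset.prod_ne_zero_iff.2 fun k _ => qNum_nat_ne_zero hℏ k

theorem pFact_neg_ne_zero (hℏ : ‖cpow ℏ 1‖ < 1) (n : ℕ) : pFact (-ℏ) n ≠ 0 := by
  rw [pFact_eq, qFact_base_neg]
  exact mul_ne_zero (cpow_ne_zero _ _) (qFact_ne_zero hℏ n)

end Scalars

/-! ### Operator powers of `q` and their commutation with `E_±`. -/

section Operators

variable {V : Type*} [NormedAddCommGroup V] [NormedSpace ℂ V] [FiniteDimensional ℂ V] {ℏ : ℂ}

theorem opPow_add_of_commute {S T : V →L[ℂ] V} (h : Commute S T) :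
    opPow ℏ (S + T) = opPow ℏ S * opPow ℏ T := by
  have := FiniteDimensional.complete ℂ V
  let : NormedAlgebra ℚ (V →L[ℂ] V) := NormedAlgebra.restrictScalars ℚ ℂ _
  rw [opPow, smul_add]
  exact NormedSpace.exp_add_of_commute ((h.smul_left ℏ).smul_right ℏ)

theorem opPow_scalar (z : ℂ) : opPow ℏ (z • (1 : V →L[ℂ] V)) = cpow ℏ z • 1 := by
  have := FiniteDimensional.complete ℂ V
  have := NormedSpace.algebraMap_exp_comm (𝕂 := ℂ) (𝔸 := V →L[ℂ] V) (ℏ * z)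
  rw [← Complex.exp_eq_exp_ℂ, Algebra.algebraMap_eq_smul_one, Algebra.algebraMap_eq_smul_one] at this
  rw [opPow, cpow, smul_smul, this]

theorem opPow_smul_apply {T : V →L[ℂ] V} {v : V} {μ : ℂ} (h : T v = μ • v) (z : ℂ) :
    opPow ℏ (z • T) v = cpow ℏ (z * μ) • v := by
  have := FiniteDimensional.complete ℂ V
  have h1 := (ContinuousLinearMap.apply ℂ V v).hasSum
    (NormedSpace.exp_series_hasSum_exp' (𝕂 := ℂ) (ℏ • z • T))
  have h2 := (NormedSpace.exp_series_hasSum_exp' (𝕂 := ℂ) (ℏ * (z * μ))).smul_const v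
  rw [← Complex.exp_eq_exp_ℂ] at h2
  refine h1.unique ?_
  have h5 : cpow ℏ (z * μ) • v = Complex.exp (ℏ * (z * μ)) • v := rfl
  rw [h5]
  refine h2.congr_fun fun n => ?_
  have h3 : ∀ n : ℕ, ((ℏ • z • T) ^ n) v = (ℏ * (z * μ)) ^ n • v := by
    intro n
    induction n with
    | zero => simp
    | succ n ih =>
      have h4 : ((ℏ • z • T) ^ (n + 1)) v = (ℏ • z • T) (((ℏ • z • T) ^ n) v) := by
        rw [pow_succ']; rfl
      rw [h4, ih, map_smul]
      change _ • (ℏ • z • T v) = _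
      rw [h, smul_smul, smul_smul, smul_smul]
      congr 1; ring
  change (n.factorial : ℂ)⁻¹ • ((ℏ • z • T) ^ n) v = _
  rw [h3, smul_assoc]

end Operators

namespace Rep

variable {ℏ : ℂ} {V : Type*} [NormedAddCommGroup V] [NormedSpace ℂ V] (ρ : Rep ℏ V)

/-- The operator `q ^ (z h)`. -/
def K (z : ℂ) : V →L[ℂ] V := opPow ℏ (z • ρ.h)

@[simp] theorem K_zero : ρ.K 0 = 1 := by simp [K, opPow]

variable [FiniteDimensional ℂ V]

theorem K_mul (a b : ℂ) : ρ.K a * ρ.K b = ρ.K (a + b) := by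
  rw [K, K, K, add_smul, opPow_add_of_commute]
  exact ((Commute.refl _).smul_left _).smul_right _

theorem K_mul_assoc (a b : ℂ) (T : V →L[ℂ] V) : ρ.K a * (ρ.K b * T) = ρ.K (a + b) * T := by
  rw [← mul_assoc, K_mul]

theorem K_pow (a : ℂ) (n : ℕ) : ρ.K a ^ n = ρ.K (n * a) := by
  induction n with
  | zero => simp
  | succ n ih => rw [pow_succ, ih, K_mul]; congr 1; push_cast; ring

theorem opPow_smul_add_one (z : ℂ) : opPow ℏ (z • (ρ.h + 1)) = cpow ℏ z • ρ.K z := by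
  rw [smul_add, opPow_add_of_commute (((Commute.one_right _).smul_left _).smul_right _),
    opPow_scalar, mul_smul_one, K]

/-- The relation says that `T` intertwines `h` with `h - w`, and intertwining passes to
exponentials. -/
theorem mul_K_of_comm {T : V →L[ℂ] V} {w : ℂ} (hT : ρ.h * T - T * ρ.h = w • T) (z : ℂ) :
    T * ρ.K z = cpow ℏ (-(z * w)) • (ρ.K z * T) := by
  have := FiniteDimensional.complete ℂ V
  let : NormedAlgebra ℚ (V →L[ℂ] V) := NormedAlgebra.restrictScalars ℚ ℂ _
  have h1 : SemiconjBy T (ℏ • z • ρ.h) (ℏ • (z • ρ.h + (-(z * w)) • 1)) := by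
    have h2 : T * ρ.h = ρ.h * T - w • T := by rw [← hT]; abel
    rw [SemiconjBy]
    simp only [mul_smul_comm, h2, smul_mul_assoc, add_mul, one_mul]
    module
  have h2 := (h1.exp_right).eq
  rw [← opPow, ← opPow, opPow_add_of_commute (((Commute.one_right _).smul_left _).smul_right _),
    opPow_scalar, mul_smul_one, smul_mul_assoc] at h2
  exact h2

theorem Ep_mul_K (z : ℂ) : ρ.Ep * ρ.K z = cpow ℏ (-(2 * z)) • (ρ.K z * ρ.Ep) := by
  rw [ρ.mul_K_of_comm ρ.h_Ep, mul_comm z]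

theorem Em_mul_K (z : ℂ) : ρ.Em * ρ.K z = cpow ℏ (2 * z) • (ρ.K z * ρ.Em) := by
  rw [ρ.mul_K_of_comm ρ.h_Em]; congr 2; ring

theorem h_mul_pow {T : V →L[ℂ] V} {w : ℂ} (hT : ρ.h * T - T * ρ.h = w • T) (n : ℕ) :
    ρ.h * T ^ n - T ^ n * ρ.h = (n * w) • T ^ n := by
  induction n with
  | zero => simp
  | succ n ih =>
    have : ρ.h * T ^ (n + 1) - T ^ (n + 1) * ρ.h
        = (ρ.h * T ^ n - T ^ n * ρ.h) * T + T ^ n * (ρ.h * T - T * ρ.h) := by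
      rw [pow_succ]; noncomm_ring
    rw [this, ih, hT, pow_succ]
    simp only [smul_mul_assoc, mul_smul_comm]
    push_cast; module

theorem Ep_pow_mul_K (n : ℕ) (z : ℂ) :
    ρ.Ep ^ n * ρ.K z = cpow ℏ (-(2 * n * z)) • (ρ.K z * ρ.Ep ^ n) := by
  rw [ρ.mul_K_of_comm (ρ.h_mul_pow ρ.h_Ep n)]; congr 2; ring

theorem Em_pow_mul_K (n : ℕ) (z : ℂ) :
    ρ.Em ^ n * ρ.K z = cpow ℏ (2 * n * z) • (ρ.K z * ρ.Em ^ n) := by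
  rw [ρ.mul_K_of_comm (ρ.h_mul_pow ρ.h_Em n)]; congr 2; ring

/-- Nonzero powers `T^n` would be eigenvectors of `ad h` for the distinct eigenvalues `n w`, and `ad
h` acts on a finite-dimensional space. No diagonalizability of `h` is needed. -/
theorem isNilpotent_of_comm {T : V →L[ℂ] V} {w : ℂ} (hw : w ≠ 0)
    (hT : ρ.h * T - T * ρ.h = w • T) : ∃ d : ℕ, ∀ n, d ≤ n → T ^ n = 0 := by
  suffices ∃ d, T ^ d = 0 by
    obtain ⟨d, hd⟩ := this
    exact ⟨d, fun n hn => pow_eq_zero_of_le hn hd⟩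
  by_contra! hne
  let A : Module.End ℂ (V →L[ℂ] V) :=
    LinearMap.mulLeft ℂ ρ.h - LinearMap.mulRight ℂ ρ.h
  have hA : ∀ n : ℕ, A.HasEigenvalue (n * w) := fun n =>
    Module.End.hasEigenvalue_of_hasEigenvector (x := T ^ n)
      ⟨Module.End.mem_eigenspace_iff.2 (by simpa [A] using ρ.h_mul_pow hT n), hne n⟩
  have hfin := Module.End.finite_hasEigenvalue A
  refine Set.infinite_of_injective_forall_mem (f := fun n : ℕ => (n : ℂ) * w) ?_ hA hfin
  intro m n h
  simpa [hw] using h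

theorem exists_Ep_pow_eq_zero : ∃ d : ℕ, ∀ n, d ≤ n → ρ.Ep ^ n = 0 :=
  ρ.isNilpotent_of_comm two_ne_zero ρ.h_Ep

theorem exists_Em_pow_eq_zero : ∃ d : ℕ, ∀ n, d ≤ n → ρ.Em ^ n = 0 :=
  ρ.isNilpotent_of_comm (neg_ne_zero.2 two_ne_zero) ρ.h_Em

theorem K_mul_Em_pow (z : ℂ) (n : ℕ) :
    (ρ.K z * ρ.Em) ^ n = cpow ℏ (z * (n * (n - 1))) • (ρ.K (n * z) * ρ.Em ^ n) := by
  induction n with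
  | zero => simp
  | succ n ih =>
    rw [pow_succ, ih, smul_mul_assoc, mul_assoc, ← mul_assoc (ρ.Em ^ n), Em_pow_mul_K,
      smul_mul_assoc, mul_smul_comm, smul_smul, mul_assoc (ρ.K z), ← pow_succ, K_mul_assoc, ← cpow_add]
    congr 3 <;> push_cast <;> ring

theorem K_mul_Ep_pow (z : ℂ) (n : ℕ) :
    (ρ.K z * ρ.Ep) ^ n = cpow ℏ (-(z * (n * (n - 1)))) • (ρ.K (n * z) * ρ.Ep ^ n) := by
  induction n with
  | zero => simp
  | succ n ih =>
    rw [pow_succ, ih, smul_mul_assoc, mul_assoc, ← mul_assoc (ρ.Ep ^ n), Ep_pow_mul_K,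
      smul_mul_assoc, mul_smul_comm, smul_smul, mul_assoc (ρ.K z), ← pow_succ, K_mul_assoc, ← cpow_add]
    congr 3 <;> push_cast <;> ring

end Rep

/-! ### Infinite products, Pochhammer operators and the `₁φ₁` summation. -/

/-- A discrete Grönwall bound: `‖P n‖` stays below `‖P 0‖ exp(∑ a)`, so the increments are summable.
It serves for both kinds of infinite product. -/
theorem cauchySeq_of_norm_sub_le_mul {E : Type*} [NormedAddCommGroup E] {P : ℕ → E} {a : ℕ → ℝ}
    (ha0 : ∀ k, 0 ≤ a k) (ha : Summable a) (h : ∀ k, ‖P (k + 1) - P k‖ ≤ a k * ‖P k‖) :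
    CauchySeq P := by
  have h1 : ∀ n, ‖P n‖ ≤ ‖P 0‖ * Real.exp (∑ k ∈ Finset.range n, a k) := by
    intro n
    induction n with
    | zero => simp
    | succ n ih =>
      rw [Finset.sum_range_succ, Real.exp_add, ← mul_assoc]
      calc ‖P (n + 1)‖ = ‖P n + (P (n + 1) - P n)‖ := by congr 1; abel
        _ ≤ ‖P n‖ + a n * ‖P n‖ := (norm_add_le _ _).trans (by gcongr; exact h n)
        _ = ‖P n‖ * (a n + 1) := by ring
        _ ≤ _ := mul_le_mul ih (Real.add_one_le_exp _) (by linarith [ha0 n]) (by positivity)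
  have h2 : ∀ n, ‖P n‖ ≤ ‖P 0‖ * Real.exp (∑' k, a k) := fun n =>
    (h1 n).trans (by gcongr; exact ha.sum_le_tsum _ fun k _ => ha0 k)
  refine cauchySeq_of_summable_dist (Summable.of_nonneg_of_le (fun _ => dist_nonneg) (fun n => ?_)
    (ha.mul_right (‖P 0‖ * Real.exp (∑' k, a k))))
  rw [dist_comm, dist_eq_norm]
  exact (h n).trans (mul_le_mul_of_nonneg_left (h2 n) (ha0 n))

section Pochhammer

variable {V : Type*} [NormedAddCommGroup V] [NormedSpace ℂ V] [FiniteDimensional ℂ V] {Q : ℂ}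

theorem tendsto_qPochPartial (hQ : ‖Q‖ < 1) (A : V →L[ℂ] V) :
    Tendsto (qPochPartial Q A) atTop (𝓝 (qPochInf Q A)) := by
  have := FiniteDimensional.complete ℂ V
  refine (cauchySeq_of_norm_sub_le_mul (a := fun k => ‖Q‖ ^ k * ‖A‖) (fun k => by positivity)
    ((summable_geometric_of_lt_one (norm_nonneg _) hQ).mul_right _)
    fun k => ?_).tendsto_limUnder
  have : qPochPartial Q A (k + 1) - qPochPartial Q A k = -(qPochPartial Q A k * Q ^ k • A) := by
    rw [qPochPartial, mul_sub, mul_one]; abel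
  rw [this, norm_neg, mul_comm]
  refine (norm_mul_le _ _).trans ?_
  rw [norm_smul, norm_pow]

theorem qPochPartial_succ' (A : V →L[ℂ] V) (n : ℕ) :
    qPochPartial Q A (n + 1) = (1 - A) * qPochPartial Q (Q • A) n := by
  induction n with
  | zero => simp [qPochPartial]
  | succ n ih =>
    rw [qPochPartial, ih, qPochPartial, mul_assoc, smul_smul, pow_succ]

theorem qPochInf_eq_mul (hQ : ‖Q‖ < 1) (A : V →L[ℂ] V) :
    qPochInf Q A = (1 - A) * qPochInf Q (Q • A) := by
  refine tendsto_nhds_unique ((tendsto_qPochPartial hQ A).comp (tendsto_add_atTop_nat 1)) ?_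
  refine ((tendsto_qPochPartial hQ (Q • A)).const_mul (1 - A)).congr fun n => ?_
  rw [Function.comp, qPochPartial_succ']

theorem commute_qPochPartial {A B : V →L[ℂ] V} (h : Commute B A) (n : ℕ) :
    Commute B (qPochPartial Q A n) := by
  induction n with
  | zero => exact Commute.one_right _
  | succ n ih => exact ih.mul_right ((Commute.one_right _).sub_right (h.smul_right _))

theorem commute_qPochInf (hQ : ‖Q‖ < 1) {A B : V →L[ℂ] V} (h : Commute B A) :
    Commute B (qPochInf Q A) := by
  refine tendsto_nhds_unique ((tendsto_qPochPartial hQ A).const_mul B) ?_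
  refine ((tendsto_qPochPartial hQ A).mul_const B).congr fun n => ?_
  exact (commute_qPochPartial h n).eq.symm

/-- The scalar product is kept as an operator so that `isUnit_qPochInf_smul_one` applies to it
directly. -/
theorem qPochInf_apply (hQ : ‖Q‖ < 1) {A : V →L[ℂ] V} {c : ℂ} {v : V} (h : A v = c • v) :
    qPochInf Q A v = qPochInf Q (c • (1 : V →L[ℂ] V)) v := by
  have ev : ∀ A : V →L[ℂ] V, Tendsto (fun n => qPochPartial Q A n v) atTop (𝓝 (qPochInf Q A v)) :=
    fun A => ((ContinuousLinearMap.apply ℂ V v).continuous.tendsto _).comp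
      (tendsto_qPochPartial hQ A)
  refine tendsto_nhds_unique (ev A) ((ev (c • 1)).congr fun n => ?_)
  induction n with
  | zero => rfl
  | succ n ih =>
    have h1 : (1 - Q ^ n • A) v = (1 - Q ^ n * c) • v := by
      change v - Q ^ n • A v = _
      rw [h]; module
    have h2 : (1 - Q ^ n • c • (1 : V →L[ℂ] V)) v = (1 - Q ^ n * c) • v := by
      change v - Q ^ n • c • v = _
      module
    change qPochPartial Q _ n ((1 - Q ^ n • c • (1 : V →L[ℂ] V)) v)
      = qPochPartial Q A n ((1 - Q ^ n • A) v)
    rw [h1, h2, map_smul, map_smul, ih]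

/-- The product `(Q ^ (k - 1) - B) ⋯ (Q - B) (1 - B)`. -/
def qShift (Q : ℂ) (B : V →L[ℂ] V) : ℕ → (V →L[ℂ] V)
  | 0 => 1
  | k + 1 => (Q ^ k • 1 - B) * qShift Q B k

/-- The scalar `c ^ k Q ^ (k (k - 1) / 2) / ((Q; Q)_k (c; Q)_k)`. -/
def phiCoeff (Q c : ℂ) (k : ℕ) : ℂ :=
  ∏ i ∈ Finset.range k, (c * Q ^ i / ((1 - Q ^ (i + 1)) * (1 - c * Q ^ i)))

theorem phiCoeff_succ (Q c : ℂ) (k : ℕ) : phiCoeff Q c (k + 1) =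
    phiCoeff Q c k * (c * Q ^ k / ((1 - Q ^ (k + 1)) * (1 - c * Q ^ k))) :=
  Finset.prod_range_succ _ _

/-- The `k`-th term of the basic hypergeometric series `₁φ₁(B⁻¹; c; Q, c B)`. -/
def phiTerm (Q c : ℂ) (B : V →L[ℂ] V) (k : ℕ) : V →L[ℂ] V := phiCoeff Q c k • qShift Q B k

theorem norm_qShift_le (hQ : ‖Q‖ < 1) (B : V →L[ℂ] V) (k : ℕ) :
    ‖qShift Q B k‖ ≤ (1 + ‖B‖) ^ k := by
  have h1 : ‖(1 : V →L[ℂ] V)‖ ≤ 1 := ContinuousLinearMap.norm_id_le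
  induction k with
  | zero => simpa [qShift] using h1
  | succ k ih =>
    rw [qShift, pow_succ']
    refine (norm_mul_le _ _).trans (mul_le_mul ?_ ih (norm_nonneg _) (by positivity))
    refine (norm_sub_le _ _).trans (add_le_add ?_ le_rfl)
    rw [norm_smul, norm_pow]
    exact mul_le_one₀ (pow_le_one₀ (norm_nonneg _) hQ.le) (norm_nonneg _) h1

/-- Ratio test: consecutive coefficients have ratio tending to `0`, thanks to the factor `Q^k`, so
any geometric growth is absorbed. -/
theorem summable_phiCoeff_mul (hQ : ‖Q‖ < 1) (c : ℂ) (b : ℝ) :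
    Summable fun k => ‖phiCoeff Q c k‖ * b ^ k := by
  have hQk : Tendsto (fun k => Q ^ k) atTop (𝓝 0) := tendsto_pow_atTop_nhds_zero_of_norm_lt_one hQ
  have h1 : Tendsto (fun k => (c * Q ^ k / ((1 - Q ^ (k + 1)) * (1 - c * Q ^ k))) * (b : ℂ))
      atTop (𝓝 ((c * 0 / ((1 - 0) * (1 - c * 0))) * b)) := by
    refine Tendsto.mul_const _ (Tendsto.div (hQk.const_mul c) (Tendsto.mul ?_ ?_) (by simp))
    · exact ((tendsto_add_atTop_iff_nat 1).2 hQk).const_sub 1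
    · exact (hQk.const_mul c).const_sub 1
  have h2 := h1.norm
  simp only [mul_zero, zero_div, zero_mul, norm_zero] at h2
  refine summable_of_ratio_norm_eventually_le (r := 1 / 2) (by norm_num) ?_
  filter_upwards [h2.eventually (ge_mem_nhds (show (0 : ℝ) < 1 / 2 by norm_num))] with k hk
  rw [phiCoeff_succ, pow_succ b]
  rw [norm_mul, Complex.norm_real] at hk
  rw [norm_mul, norm_mul _ (b ^ k), norm_norm, norm_mul, norm_mul (b ^ k), norm_norm]
  calc _ = (‖c * Q ^ k / ((1 - Q ^ (k + 1)) * (1 - c * Q ^ k))‖ * ‖b‖) *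
        (‖phiCoeff Q c k‖ * ‖b ^ k‖) := by
          generalize ‖c * Q ^ k / ((1 - Q ^ (k + 1)) * (1 - c * Q ^ k))‖ = t
          ring
    _ ≤ _ := by gcongr

theorem norm_phiTerm_le (hQ : ‖Q‖ < 1) (c : ℂ) {B : V →L[ℂ] V} {b : ℝ} (hb : ‖B‖ ≤ b) (k : ℕ) :
    ‖phiTerm Q c B k‖ ≤ ‖phiCoeff Q c k‖ * (1 + b) ^ k := by
  rw [phiTerm, norm_smul]
  gcongr
  exact (norm_qShift_le hQ B k).trans (by gcongr)

theorem summable_norm_phiTerm (hQ : ‖Q‖ < 1) (c : ℂ) (B : V →L[ℂ] V) :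
    Summable fun k => ‖phiTerm Q c B k‖ :=
  Summable.of_nonneg_of_le (fun _ => norm_nonneg _) (norm_phiTerm_le hQ c le_rfl)
    (summable_phiCoeff_mul hQ c _)

theorem summable_phiTerm (hQ : ‖Q‖ < 1) (c : ℂ) (B : V →L[ℂ] V) : Summable (phiTerm Q c B) := by
  have := FiniteDimensional.complete ℂ V
  exact (summable_norm_phiTerm hQ c B).of_norm

theorem qShift_smul_succ (B : V →L[ℂ] V) (k : ℕ) :
    qShift Q (Q • B) (k + 1) = Q ^ k • ((1 - Q • B) * qShift Q B k) := by
  induction k with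
  | zero => simp [qShift]
  | succ k ih =>
    rw [qShift, ih, qShift]
    have h : Commute (1 - Q • B) (Q ^ k • 1 - B) :=
      ((Commute.one_left _).sub_left
        ((((Commute.one_right _).smul_right _).sub_right (Commute.refl _)).smul_left _))
    rw [← mul_assoc (1 - Q • B), h.eq, mul_assoc, mul_smul_comm, ← smul_mul_assoc, ← mul_assoc,
      ← mul_assoc, ← smul_mul_assoc, ← smul_mul_assoc]
    congr 2
    rw [smul_sub, smul_sub, smul_smul, smul_smul, pow_succ]
    match_scalars <;> ring

/-- The functional equation `S(B) = (1 - cB) S(QB)` of the `₁φ₁` series holds for partial sums up to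
an explicit remainder, which tends to `0`. -/
theorem sum_phiTerm_sub (hQ : ‖Q‖ < 1) {c : ℂ} (hc : ∀ i : ℕ, 1 - c * Q ^ i ≠ 0)
    (B : V →L[ℂ] V) (n : ℕ) :
    ∑ k ∈ Finset.range (n + 1), phiTerm Q c B k
      - (1 - c • B) * ∑ k ∈ Finset.range (n + 1), phiTerm Q c (Q • B) k
      = (c * Q ^ n) • (B * phiTerm Q c B n) := by
  induction n with
  | zero => simp [phiTerm, qShift, phiCoeff]
  | succ n ih =>
    rw [Finset.sum_range_succ, Finset.sum_range_succ _ (n + 1), mul_add, add_sub_add_comm, ih]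
    have hQ1 : 1 - Q ^ (n + 1) ≠ 0 := by
      intro h
      have h1 : ‖Q‖ ^ (n + 1) < 1 := pow_lt_one₀ (norm_nonneg _) hQ n.succ_ne_zero
      rw [← norm_pow, ← sub_eq_zero.1 h] at h1
      simp at h1
    have h1 : c * Q ^ n * phiCoeff Q c n
        = phiCoeff Q c (n + 1) * ((1 - Q ^ (n + 1)) * (1 - c * Q ^ n)) := by
      rw [phiCoeff_succ]
      have := hc n
      field_simp
    simp only [phiTerm]
    rw [mul_smul_comm, smul_smul, h1, qShift_smul_succ, qShift]
    simp only [mul_sub, sub_mul, smul_mul_assoc, mul_smul_comm, one_mul, smul_sub, smul_smul]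
    match_scalars <;> ring

theorem tsum_phiTerm_eq_mul (hQ : ‖Q‖ < 1) {c : ℂ} (hc : ∀ i : ℕ, 1 - c * Q ^ i ≠ 0)
    (B : V →L[ℂ] V) :
    ∑' k, phiTerm Q c B k = (1 - c • B) * ∑' k, phiTerm Q c (Q • B) k := by
  have h1 := fun B : V →L[ℂ] V =>
    ((summable_phiTerm hQ c B).hasSum.tendsto_sum_nat).comp (tendsto_add_atTop_nat 1)
  have h2 : Tendsto (fun n => (c * Q ^ n) • (B * phiTerm Q c B n)) atTop (𝓝 0) := by
    have := ((tendsto_pow_atTop_nhds_zero_of_norm_lt_one hQ).const_mul c).smul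
      ((summable_phiTerm hQ c B).tendsto_atTop_zero.const_mul B)
    simpa using this
  have h3 := (h1 B).sub ((h1 (Q • B)).const_mul (1 - c • B))
  refine sub_eq_zero.1 (tendsto_nhds_unique h3 (h2.congr fun n => ?_))
  exact (sum_phiTerm_sub hQ hc B n).symm

/-- Iterating the functional equation and letting `Q^n B → 0` gives `S(B) = (cB; Q)_∞ S(0)`. The
unknown `S(0)` is eliminated by taking `B = 1`, where only the term `k = 0` survives. -/
theorem qPochInf_mul_tsum_phiTerm (hQ : ‖Q‖ < 1) {c : ℂ} (hc : ∀ i : ℕ, 1 - c * Q ^ i ≠ 0)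
    (B : V →L[ℂ] V) :
    qPochInf Q (c • (1 : V →L[ℂ] V)) * ∑' k, phiTerm Q c B k = qPochInf Q (c • B) := by
  have := FiniteDimensional.complete ℂ V
  have h1 : ∀ (B : V →L[ℂ] V) (n : ℕ), ∑' k, phiTerm Q c B k
      = qPochPartial Q (c • B) n * ∑' k, phiTerm Q c (Q ^ n • B) k := by
    intro B n
    induction n with
    | zero => simp [qPochPartial]
    | succ n ih =>
      rw [ih, tsum_phiTerm_eq_mul hQ hc (Q ^ n • B), qPochPartial, mul_assoc, smul_smul c,
        smul_smul Q, smul_smul _ c, mul_comm c, pow_succ']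
  have h2 : ∀ B : V →L[ℂ] V, ∑' k, phiTerm Q c B k
      = qPochInf Q (c • B) * ∑' k, phiTerm Q c (0 : V →L[ℂ] V) k := by
    intro B
    have h3 : Tendsto (fun n => ∑' k, phiTerm Q c (Q ^ n • B) k) atTop
        (𝓝 (∑' k, phiTerm Q c (0 : V →L[ℂ] V) k)) := by
      refine tendsto_tsum_of_dominated_convergence (summable_phiCoeff_mul hQ c (1 + ‖B‖)) ?_ ?_
      · intro k
        have h4 : Tendsto (fun n => Q ^ n • B) atTop (𝓝 0) := by
          simpa using (tendsto_pow_atTop_nhds_zero_of_norm_lt_one hQ).smul_const B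
        have h5 : Continuous fun B : V →L[ℂ] V => phiTerm Q c B k := by
          suffices Continuous fun B : V →L[ℂ] V => qShift Q B k from
            (continuous_const_smul (phiCoeff Q c k)).comp this
          induction k with
          | zero => exact continuous_const
          | succ k ih => exact (continuous_const.sub continuous_id).mul ih
        have h6 := h5.tendsto 0
        exact h6.comp h4
      · refine Eventually.of_forall fun n k => norm_phiTerm_le hQ c ?_ k
        rw [norm_smul, norm_pow]
        exact mul_le_of_le_one_left (norm_nonneg _) (pow_le_one₀ (norm_nonneg _) hQ.le)
    refine tendsto_nhds_unique tendsto_const_nhds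
      (((tendsto_qPochPartial hQ (c • B)).mul h3).congr fun n => (h1 B n).symm)
  have h3 : ∑' k, phiTerm Q c (1 : V →L[ℂ] V) k = 1 := by
    rw [tsum_eq_single 0]
    · simp [phiTerm, phiCoeff, qShift]
    · intro k hk
      obtain ⟨k, rfl⟩ := Nat.exists_eq_succ_of_ne_zero hk
      have : ∀ k, qShift Q (1 : V →L[ℂ] V) (k + 1) = 0 := by
        intro k
        induction k with
        | zero => simp [qShift]
        | succ k ih => rw [qShift, ih, mul_zero]
      rw [phiTerm, this, smul_zero]
  have h4 : Commute (qPochInf Q (c • B)) (qPochInf Q (c • (1 : V →L[ℂ] V))) :=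
    commute_qPochInf hQ ((Commute.one_right _).smul_right _)
  rw [h2 B, ← mul_assoc, ← h4.eq, mul_assoc, ← h2 1, h3, mul_one]

/-- The summation formula at `B = 0` exhibits the inverse as a convergent series. -/
theorem isUnit_qPochInf_smul_one (hQ : ‖Q‖ < 1) {c : ℂ} (hc : ∀ i : ℕ, 1 - c * Q ^ i ≠ 0) :
    IsUnit (qPochInf Q (c • (1 : V →L[ℂ] V))) := by
  have h1 := qPochInf_mul_tsum_phiTerm hQ hc (0 : V →L[ℂ] V)
  have h2 : qPochInf Q (c • (0 : V →L[ℂ] V)) = 1 := by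
    refine tendsto_nhds_unique (tendsto_qPochPartial hQ _) (tendsto_const_nhds.congr fun n => ?_)
    induction n with
    | zero => rfl
    | succ n ih =>
      rw [smul_zero] at ih
      simp [qPochPartial, ← ih]
  rw [h2] at h1
  have h3 : Commute (∑' k, phiTerm Q c (0 : V →L[ℂ] V) k)
      (qPochInf Q (c • (1 : V →L[ℂ] V))) :=
    commute_qPochInf hQ ((Commute.one_right _).smul_right _)
  exact ⟨⟨_, _, h1, h3.eq.trans h1⟩, rfl⟩

end Pochhammer

/-! ### Normal ordering of `E_+^n E_-^m`. -/

namespace Rep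

variable {ℏ : ℂ} {V : Type*} [NormedAddCommGroup V] [NormedSpace ℂ V] [FiniteDimensional ℂ V]
  (ρ : Rep ℏ V)

/-- The operator `[h + z]_q`. -/
def hNum (z : ℂ) : V →L[ℂ] V :=
  (cpow ℏ 1 - cpow ℏ (-1))⁻¹ • (cpow ℏ z • ρ.K 1 - cpow ℏ (-z) • ρ.K (-1))

theorem hNum_zero : ρ.hNum 0 = opNum ℏ ρ.h := by simp [hNum, opNum, K]

theorem hNum_comm (y z : ℂ) : ρ.hNum y * ρ.hNum z = ρ.hNum z * ρ.hNum y := by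
  simp only [hNum, smul_mul_assoc, mul_smul_comm, sub_mul, mul_sub, K_mul]
  rw [show (-1 : ℂ) + 1 = 1 + -1 by ring]
  module

theorem Ep_mul_hNum (z : ℂ) : ρ.Ep * ρ.hNum z = ρ.hNum (z - 2) * ρ.Ep := by
  simp only [hNum, smul_mul_assoc, mul_smul_comm, sub_mul, mul_sub, Ep_mul_K, smul_smul, ← cpow_add]
  ring_nf

theorem Em_pow_mul_hNum (n : ℕ) (z : ℂ) :
    ρ.Em ^ n * ρ.hNum z = ρ.hNum (z + 2 * n) * ρ.Em ^ n := by
  simp only [hNum, smul_mul_assoc, mul_smul_comm, sub_mul, mul_sub, Em_pow_mul_K, smul_smul,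
    ← cpow_add]
  ring_nf

variable (hℏ : ‖cpow ℏ 1‖ < 1)

include hℏ

/-- The operator form of the q-number identity behind the q-Pascal rule; it drives both
normal-ordering inductions. -/
theorem qNum_add_smul_hNum (a b y : ℂ) :
    qNum ℏ (a + b) • ρ.hNum (y - a - b) = qNum ℏ b • ρ.hNum (y - 2 * a - b)
      + qNum ℏ a • ρ.hNum (y - a) := by
  have hδ := cpow_one_sub_ne_zero hℏ
  have ha := cpow_ne_zero ℏ a
  have hb := cpow_ne_zero ℏ b
  have hy := cpow_ne_zero ℏ y
  simp only [hNum, smul_smul, smul_sub, qNum]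
  simp only [neg_sub, cpow_sub, cpow_add, cpow_neg ℏ a, cpow_neg ℏ b, neg_add, two_mul]
  generalize cpow ℏ 1 - cpow ℏ (-1) = δ at *
  match_scalars <;> field_simp <;> ring

theorem Ep_mul_Em_pow (j : ℕ) : ρ.Ep * ρ.Em ^ j
    = ρ.Em ^ j * ρ.Ep + qNum ℏ j • (ρ.hNum (j - 1) * ρ.Em ^ (j - 1)) := by
  induction j with
  | zero => simp
  | succ j ih =>
    have h1 : ρ.Ep * ρ.Em = ρ.Em * ρ.Ep + ρ.hNum 0 := by
      rw [hNum_zero, ← ρ.Ep_Em]; abel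
    have h2 : (qNum ℏ j • (ρ.hNum (j - 1) * ρ.Em ^ (j - 1))) * ρ.Em
        = (qNum ℏ j • ρ.hNum (j - 1)) * ρ.Em ^ j := by
      cases j with
      | zero => simp
      | succ j => rw [Nat.add_sub_cancel, smul_mul_assoc, mul_assoc, ← pow_succ, smul_mul_assoc]
    have h3 := ρ.qNum_add_smul_hNum hℏ 1 j (2 * j + 1)
    have h4 : qNum ℏ 1 = 1 := div_self (cpow_one_sub_ne_zero hℏ)
    rw [pow_succ, ← mul_assoc, ih, add_mul, h2, mul_assoc, h1, mul_add, Em_pow_mul_hNum,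
      Nat.add_sub_cancel, mul_assoc, add_assoc, ← add_mul, ← smul_mul_assoc]
    congr 2
    rw [h4, one_smul] at h3
    rw [add_comm]
    push_cast
    convert h3.symm using 3 <;> ring_nf

omit hℏ

/-- The product `[h + z]_q [h + z - 1]_q ⋯ [h + z - k + 1]_q`. -/
def hFall (z : ℂ) : ℕ → (V →L[ℂ] V)
  | 0 => 1
  | k + 1 => ρ.hNum (z - k) * hFall z k

theorem commute_hNum_hFall (y z : ℂ) (k : ℕ) : Commute (ρ.hNum y) (ρ.hFall z k) := by
  induction k with
  | zero => exact Commute.one_right _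
  | succ k ih => exact Commute.mul_right (ρ.hNum_comm _ _) ih

theorem hFall_succ' (z : ℂ) (k : ℕ) : ρ.hFall z (k + 1) = ρ.hNum z * ρ.hFall (z - 1) k := by
  induction k with
  | zero => simp [hFall]
  | succ k ih =>
    rw [hFall, ih, hFall, ← mul_assoc, ← mul_assoc, hNum_comm]
    congr 3; push_cast; ring

theorem Ep_mul_hFall (z : ℂ) (k : ℕ) : ρ.Ep * ρ.hFall z k = ρ.hFall (z - 2) k * ρ.Ep := by
  induction k with
  | zero => simp [hFall]
  | succ k ih =>
    rw [hFall, hFall, ← mul_assoc, Ep_mul_hNum, mul_assoc, ih, mul_assoc]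
    congr 2; ring

/-- The falling factorial `[m]_q [m - 1]_q ⋯ [m - k + 1]_q`. -/
def qFall (ℏ : ℂ) (m k : ℕ) : ℂ := ∏ s ∈ Finset.range k, qNum ℏ ((m : ℂ) - s)

theorem qFall_succ (m k : ℕ) : qFall ℏ m (k + 1) = qFall ℏ m k * qNum ℏ ((m : ℂ) - k) :=
  Finset.prod_range_succ _ _

theorem qFall_eq_zero {m k : ℕ} (h : m < k) : qFall ℏ m k = 0 :=
  Finset.prod_eq_zero (Finset.mem_range.2 h) (by simp)

theorem qFall_mul_qFact (a k : ℕ) : qFall ℏ (a + k) k * qFact ℏ a = qFact ℏ (a + k) := by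
  induction k generalizing a with
  | zero => simp [qFall]
  | succ k ih =>
    rw [qFall_succ, ← add_assoc, add_right_comm, mul_assoc, ← ih (a + 1), qFact_succ]
    congr 1
    rw [mul_comm]
    congr 2
    push_cast; ring

-- The factor `qFall` is carried along because it vanishes for `k > m`, which makes the truncated
-- exponents `m - k` harmless.
include hℏ in
theorem qFall_smul_Ep_mul (m k : ℕ) : qFall ℏ m k • (ρ.Ep * ρ.Em ^ (m - k)) =
    qFall ℏ m k • (ρ.Em ^ (m - k) * ρ.Ep)
      + qFall ℏ m (k + 1) • (ρ.hNum (m - k - 1) * ρ.Em ^ (m - (k + 1))) := by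
  rcases le_or_gt k m with hk | hk
  · rw [Ep_mul_Em_pow ρ hℏ, smul_add, smul_smul, qFall_succ, Nat.cast_sub hk, Nat.sub_sub]
  · simp [qFall_eq_zero hk, qFall_succ]

-- Induction on `n`: a new `E_+` either passes `E_-^(m-k)` or is absorbed by it, leaving a Cartan
-- factor. The two resulting families recombine by the q-Pascal rule.
include hℏ in
theorem Ep_pow_mul_Em_pow (n m : ℕ) : ρ.Ep ^ n * ρ.Em ^ m =
    ∑ kb ∈ Finset.HasAntidiagonal.antidiagonal n,
      (qFact ℏ n / (qFact ℏ kb.1 * qFact ℏ kb.2) * qFall ℏ m kb.1) •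
        (ρ.hFall (m - n) kb.1 * (ρ.Em ^ (m - kb.1) * ρ.Ep ^ kb.2)) := by
  induction n with
  | zero => simp [qFall, hFall]
  | succ n ih =>
    -- `F₁` collects the terms where `E_+` passes, `F₂` those where it is absorbed. The factors
    -- `[b]_q` and `[k]_q` vanish at one end, so both sums can run over the whole antidiagonal of `n
    -- + 1`.
    let F₁ : ℕ × ℕ → (V →L[ℂ] V) := fun kb =>
      (qFact ℏ n / (qFact ℏ kb.1 * qFact ℏ kb.2) * qFall ℏ m kb.1 * qNum ℏ kb.2) •
        (ρ.hFall (m - n - 2) kb.1 * (ρ.Em ^ (m - kb.1) * ρ.Ep ^ kb.2))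
    let F₂ : ℕ × ℕ → (V →L[ℂ] V) := fun kb =>
      (qFact ℏ n / (qFact ℏ kb.1 * qFact ℏ kb.2) * qFall ℏ m kb.1 * qNum ℏ kb.1) •
        (ρ.hFall (m - n - 2) (kb.1 - 1) * ρ.hNum (m - kb.1) *
          (ρ.Em ^ (m - kb.1) * ρ.Ep ^ kb.2))
    have h1 : ρ.Ep ^ (n + 1) * ρ.Em ^ m
        = ∑ kb ∈ Finset.HasAntidiagonal.antidiagonal (n + 1), F₁ kb + ∑ kb ∈ Finset.HasAntidiagonal.antidiagonal (n + 1), F₂ kb := by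
      rw [Finset.Nat.sum_antidiagonal_succ' (f := F₁), Finset.Nat.sum_antidiagonal_succ (f := F₂)]
      have h2 : F₁ (n + 1, 0) = 0 := by simp [F₁]
      have h3 : F₂ (0, n + 1) = 0 := by simp [F₂]
      rw [h2, h3, zero_add, zero_add, ← Finset.sum_add_distrib, pow_succ', mul_assoc, ih,
        Finset.mul_sum]
      refine Finset.sum_congr rfl fun ⟨k, b⟩ _ => ?_
      have hk := qFact_ne_zero hℏ k
      have hb := qFact_ne_zero hℏ b
      have hk' := qNum_nat_ne_zero hℏ k
      have hb' := qNum_nat_ne_zero hℏ b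
      have h4 := ρ.qFall_smul_Ep_mul hℏ m k
      simp only [F₁, F₂]
      rw [mul_smul_comm, ← mul_assoc ρ.Ep, Ep_mul_hFall, mul_assoc, ← mul_assoc ρ.Ep, mul_smul,
        ← mul_smul_comm, ← smul_mul_assoc (qFall ℏ m k) (ρ.Ep * _), h4, add_mul, mul_add, smul_add, smul_mul_assoc,
        mul_smul_comm, smul_smul, smul_mul_assoc, mul_smul_comm, smul_smul, Nat.add_sub_cancel,
        mul_assoc (ρ.Em ^ _), ← pow_succ', qFact_succ, qFact_succ]
      have e1 : ((k + 1 : ℕ) : ℂ) = k + 1 := by push_cast; rfl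
      have e2 : ((b + 1 : ℕ) : ℂ) = b + 1 := by push_cast; rfl
      rw [e1, e2, ← sub_sub, mul_assoc (ρ.hFall _ _)  (ρ.hNum _), mul_assoc (ρ.hNum _)]
      congr 2 <;> field_simp
    rw [h1, ← Finset.sum_add_distrib]
    refine Finset.sum_congr rfl fun ⟨k, b⟩ hkb => ?_
    have hn : (n : ℂ) + 1 = k + b := by
      exact_mod_cast (Finset.HasAntidiagonal.mem_antidiagonal.1 hkb).symm
    have h4 : qNum ℏ (n + 1) • ρ.hFall (m - (n + 1 : ℕ)) k
        = qNum ℏ b • ρ.hFall (m - n - 2) k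
          + qNum ℏ k • (ρ.hFall (m - n - 2) (k - 1) * ρ.hNum (m - k)) := by
      cases k with
      | zero =>
        simp only [hFall]
        simp [hn]
      | succ k =>
        have h5 := ρ.qNum_add_smul_hNum hℏ (k + 1) b m
        rw [hFall_succ', Nat.add_sub_cancel, hFall, ← (ρ.commute_hNum_hFall _ _ _).eq,
          ← smul_mul_assoc, ← smul_mul_assoc, ← smul_mul_assoc]
        have e1 : (m : ℂ) - (n + 1 : ℕ) - 1 = m - n - 2 := by push_cast; ring
        rw [e1, ← add_mul, hn]
        push_cast at h5 hn ⊢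
        congr 1
        convert h5 using 3
        · rw [hn]; ring_nf
        · rw [show (n : ℂ) = k + 1 + b - 1 by rw [← hn]; ring]; ring_nf
    simp only [F₁, F₂]
    rw [qFact_succ, mul_smul _ (qNum ℏ _), mul_smul _ (qNum ℏ _), ← smul_add, ← smul_mul_assoc,
      ← smul_mul_assoc, ← add_mul, ← h4, smul_mul_assoc, smul_smul]
    congr 1
    ring

end Rep

/-! ### The normally ordered form of `M(x)`. -/

theorem one_sub_cpow_two_pow_ne_zero {ℏ : ℂ} (hℏ : ‖cpow ℏ 1‖ < 1) (k : ℕ) :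
    1 - cpow ℏ 2 ^ (k + 1) ≠ 0 := by
  rw [cpow_two, ← pow_mul, sub_ne_zero]
  exact (cpow_one_pow_ne_one hℏ (by omega)).symm

/-- The finite product `(C; Q)_n` of numbers. -/
def numPoch (Q C : ℂ) (n : ℕ) : ℂ := ∏ i ∈ Finset.range n, (1 - C * Q ^ i)

theorem numPoch_succ (Q C : ℂ) (n : ℕ) : numPoch Q C (n + 1) = numPoch Q C n * (1 - C * Q ^ n) :=
  Finset.prod_range_succ _ _

theorem numPoch_ne_zero {Q C : ℂ} (h : ∀ i : ℕ, 1 - C * Q ^ i ≠ 0) (n : ℕ) : numPoch Q C n ≠ 0 :=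
  Finset.prod_ne_zero_iff.2 fun i _ => h i

section

variable {ℏ : ℂ} (hℏ : ‖cpow ℏ 1‖ < 1) {x : ℂ} (hx : x ≠ 0)

include hx in
theorem prod_MTerm_denominator (n : ℕ) :
    ∏ p ∈ Finset.Icc 1 n, (x * cpow ℏ (p : ℂ) - x⁻¹ * cpow ℏ (-(p : ℂ)))
      = (-1) ^ n * (x ^ n)⁻¹ * cpow ℏ (-((n : ℂ) * (n + 1) / 2))
        * numPoch (cpow ℏ 2) (cpow ℏ 2 * x ^ 2) n := by
  induction n with
  | zero => simp [numPoch]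
  | succ n ih =>
    rw [Finset.prod_Icc_succ_top (by omega), ih, numPoch_succ]
    have e1 : -(((n + 1 : ℕ) : ℂ) * ((n + 1 : ℕ) + 1) / 2)
        = -((n : ℂ) * (n + 1) / 2) + -((n + 1 : ℕ) : ℂ) := by push_cast; ring
    have e2 : cpow ℏ 2 * x ^ 2 * cpow ℏ 2 ^ n = x ^ 2 * cpow ℏ ((n + 1 : ℕ) : ℂ) ^ 2 := by
      rw [mul_right_comm, ← pow_succ', cpow_nat ℏ (n + 1), cpow_two]; ring
    rw [e1, e2, cpow_add, cpow_neg ℏ ((n + 1 : ℕ) : ℂ)]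
    have h1 := cpow_ne_zero ℏ ((n + 1 : ℕ) : ℂ)
    field_simp
    ring

include hℏ in
theorem phiCoeff_mul_numPoch {C : ℂ} (hC : ∀ i : ℕ, 1 - C * cpow ℏ 2 ^ i ≠ 0) (b k : ℕ) :
    phiCoeff (cpow ℏ 2) (C * cpow ℏ 2 ^ b) k * (numPoch (cpow ℏ 2) C (b + k) *
      ((cpow ℏ (-1) - cpow ℏ 1) ^ k * cpow ℏ ((k : ℂ) * (k + 1) / 2) * qFact ℏ k))
    = numPoch (cpow ℏ 2) C b * (C ^ k * cpow ℏ (2 * (b * k) + k * (k - 1))) := by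
  induction k with
  | zero => simp [phiCoeff]
  | succ k ih =>
    have e1 : 2 * ((b : ℂ) * (k + 1 : ℕ)) + (k + 1 : ℕ) * ((k + 1 : ℕ) - 1)
        = (2 * (b * k) + k * (k - 1)) + b * 2 + k * 2 := by push_cast; ring
    have e2 : ((k + 1 : ℕ) : ℂ) * ((k + 1 : ℕ) + 1) / 2 = (k : ℂ) * (k + 1) / 2 + (k + 1) := by
      push_cast; ring
    have h1 : (cpow ℏ (-1) - cpow ℏ 1) * cpow ℏ (k + 1) * qNum ℏ (k + 1)
        = 1 - cpow ℏ 2 ^ (k + 1) := by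
      have h2 := cpow_one_sub_ne_zero hℏ
      have h3 : cpow ℏ 2 ^ (k + 1) = cpow ℏ (k + 1) * cpow ℏ (k + 1) := by
        rw [← cpow_nat_mul, ← cpow_add]; congr 1; push_cast; ring
      rw [qNum, h3, cpow_neg ℏ ((k : ℂ) + 1)]
      have h4 := cpow_ne_zero ℏ ((k : ℂ) + 1)
      field_simp
      ring
    rw [e1, e2, cpow_add ℏ (_ / 2), cpow_add ℏ _ (k * 2), cpow_add ℏ _ (b * 2), cpow_nat_mul,
      cpow_nat_mul, ← add_assoc,
      numPoch_succ, phiCoeff_succ, qFact_succ, pow_succ C, pow_succ (cpow ℏ (-1) - cpow ℏ 1)]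
    have h5 := hC (b + k)
    rw [pow_add, ← mul_assoc] at h5
    have h6 := one_sub_cpow_two_pow_ne_zero hℏ k
    calc _ = phiCoeff (cpow ℏ 2) (C * cpow ℏ 2 ^ b) k * (numPoch (cpow ℏ 2) C (b + k) *
          ((cpow ℏ (-1) - cpow ℏ 1) ^ k * cpow ℏ ((k : ℂ) * (k + 1) / 2) * qFact ℏ k)) *
          (C * cpow ℏ 2 ^ b * cpow ℏ 2 ^ k / ((1 - cpow ℏ 2 ^ (k + 1)) *
            (1 - C * cpow ℏ 2 ^ b * cpow ℏ 2 ^ k)) * (1 - C * cpow ℏ 2 ^ b * cpow ℏ 2 ^ k) *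
            ((cpow ℏ (-1) - cpow ℏ 1) * cpow ℏ (k + 1) * qNum ℏ (k + 1))) := by
          rw [pow_add]; ring
      _ = _ := by
          rw [ih, h1]
          field_simp

-- The left side gathers every scalar met in normal ordering one term of `M`: Babelon's coefficient,
-- the cost of moving the power of `q^h` to the left, the q-binomial factors, and the constants of
-- `hFall_eq`. All dependence on `k` collapses into `phiCoeff`.
include hℏ hx in
theorem MTerm_coeff_eq (hC : ∀ i : ℕ, 1 - cpow ℏ 2 * x ^ 2 * cpow ℏ 2 ^ i ≠ 0) (a b k n m : ℕ)
    (hn : n = b + k) (hm : m = a + k) :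
    ((-1) ^ m * x ^ m * cpow ℏ ((n : ℂ) * ((n : ℂ) - 1) / 2 + (m : ℂ) * ((n : ℂ) - (m : ℂ)))) /
      (qFact ℏ m * qFact ℏ n *
        ∏ p ∈ Finset.Icc 1 n, (x * cpow ℏ (p : ℂ) - x⁻¹ * cpow ℏ (-(p : ℂ)))) *
      cpow ℏ (2 * ((m : ℂ) - n) * ((n + m) / 2)) *
      (qFact ℏ n / (qFact ℏ k * qFact ℏ b) * (qFact ℏ m / qFact ℏ a)) *
      ((cpow ℏ (-1) - cpow ℏ 1) ^ k)⁻¹ * cpow ℏ (-(k * (m - n) + k * (k - 1) / 2))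
    = (-x) ^ (a + b) * cpow ℏ (a * b) /
        (numPoch (cpow ℏ 2) (cpow ℏ 2 * x ^ 2) b * qFact ℏ a * qFact ℏ b) *
      phiCoeff (cpow ℏ 2) (cpow ℏ 2 * x ^ 2 * cpow ℏ 2 ^ b) k := by
  have h1 := phiCoeff_mul_numPoch hℏ hC b k
  have hδ : cpow ℏ (-1) - cpow ℏ 1 ≠ 0 := by
    rw [← neg_sub, neg_ne_zero]; exact cpow_one_sub_ne_zero hℏ
  have hb := numPoch_ne_zero hC b
  have hbk := numPoch_ne_zero hC (b + k)
  have fa := qFact_ne_zero hℏ a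
  have fb := qFact_ne_zero hℏ b
  have fk := qFact_ne_zero hℏ k
  have fn := qFact_ne_zero hℏ n
  have fm := qFact_ne_zero hℏ m
  rw [prod_MTerm_denominator hx]
  have h2 : phiCoeff (cpow ℏ 2) (cpow ℏ 2 * x ^ 2 * cpow ℏ 2 ^ b) k
      = numPoch (cpow ℏ 2) (cpow ℏ 2 * x ^ 2) b * (x ^ 2) ^ k
        * cpow ℏ (2 * k + 2 * (b * k) + k * (k - 1) - k * (k + 1) / 2)
        / (numPoch (cpow ℏ 2) (cpow ℏ 2 * x ^ 2) (b + k)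
          * (cpow ℏ (-1) - cpow ℏ 1) ^ k * qFact ℏ k) := by
    rw [eq_div_iff (by positivity), cpow_sub, mul_div_assoc', eq_div_iff (cpow_ne_zero _ _)]
    have h3 : cpow ℏ (2 * k + 2 * (b * k) + k * (k - 1))
        = cpow ℏ 2 ^ k * cpow ℏ (2 * (b * k) + k * (k - 1)) := by
      rw [← cpow_nat_mul, ← cpow_add]; congr 1; ring
    rw [h3]
    rw [mul_pow] at h1
    linear_combination h1
  rw [h2, cpow_neg ℏ ((n : ℂ) * (n + 1) / 2)]
  have e : cpow ℏ ((n : ℂ) * ((n : ℂ) - 1) / 2 + (m : ℂ) * ((n : ℂ) - (m : ℂ))) *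
      cpow ℏ (2 * ((m : ℂ) - n) * ((n + m) / 2)) * cpow ℏ (-(k * (m - n) + k * (k - 1) / 2)) *
      cpow ℏ ((n : ℂ) * (n + 1) / 2)
      = cpow ℏ (a * b) * cpow ℏ (2 * k + 2 * (b * k) + k * (k - 1) - k * (k + 1) / 2) := by
    simp only [← cpow_add]
    congr 1
    subst hn hm
    push_cast
    ring
  generalize cpow ℏ ((n : ℂ) * ((n : ℂ) - 1) / 2 + (m : ℂ) * ((n : ℂ) - (m : ℂ))) = c1 at *
  generalize cpow ℏ (2 * ((m : ℂ) - n) * ((n + m) / 2)) = c2 at *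
  generalize cpow ℏ (-(k * (m - n) + k * (k - 1) / 2)) = c3 at *
  have h4 := cpow_ne_zero ℏ ((n : ℂ) * (n + 1) / 2)
  generalize cpow ℏ ((n : ℂ) * (n + 1) / 2) = c4 at *
  generalize cpow ℏ (2 * k + 2 * (b * k) + k * (k - 1) - k * (k + 1) / 2) = c5 at *
  generalize cpow ℏ (-1) - cpow ℏ 1 = δ at *
  have hs : ((-1 : ℂ)) ^ m * ((-1) ^ n)⁻¹ = (-1) ^ (a + b) := by
    subst hn hm
    rw [← inv_pow, inv_neg, inv_one, ← pow_add]
    rw [show a + k + (b + k) = a + b + 2 * k by ring, pow_add _ _ (2 * k), pow_mul]; simp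
  have hxx : x ^ m * x ^ n = x ^ (a + b) * (x ^ 2) ^ k := by
    subst hn hm; ring
  rw [← hn] at hbk ⊢
  rw [neg_pow x]
  clear h1 h2
  generalize numPoch (cpow ℏ 2) (cpow ℏ 2 * x ^ 2) n = P at *
  generalize numPoch (cpow ℏ 2) (cpow ℏ 2 * x ^ 2) b = P' at *
  calc _ = ((-1 : ℂ) ^ m * ((-1) ^ n)⁻¹) * (x ^ m * x ^ n) * (c1 * c2 * c3 * c4) /
        (P * qFact ℏ k * qFact ℏ a * qFact ℏ b * δ ^ k) := by
        field_simp
    _ = _ := by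
        rw [hs, hxx, e]
        field_simp

end

section

variable {V : Type*} [NormedAddCommGroup V] [NormedSpace ℂ V] [FiniteDimensional ℂ V]

theorem qPochInf_smul_one_eq_numPoch_smul {Q : ℂ} (hQ : ‖Q‖ < 1) (C : ℂ) (n : ℕ) :
    qPochInf Q (C • (1 : V →L[ℂ] V)) =
      numPoch Q C n • qPochInf Q ((C * Q ^ n) • (1 : V →L[ℂ] V)) := by
  induction n with
  | zero => simp [numPoch]
  | succ n ih =>
    have h : (1 : V →L[ℂ] V) - (C * Q ^ n) • 1 = (1 - C * Q ^ n) • 1 := by module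
    have e : C * Q ^ (n + 1) = Q * (C * Q ^ n) := by ring
    rw [ih, e, ← smul_smul Q, qPochInf_eq_mul hQ ((C * Q ^ n) • (1 : V →L[ℂ] V)), numPoch_succ, h,
      smul_one_mul, smul_smul (numPoch _ _ _)]

theorem commute_qShift {Q : ℂ} {A B : V →L[ℂ] V} (h : Commute A B) (k : ℕ) :
    Commute A (qShift Q B k) := by
  induction k with
  | zero => exact Commute.one_right _
  | succ k ih => exact (((Commute.one_right _).smul_right _).sub_right h).mul_right ih

end

namespace Rep

variable {ℏ : ℂ} {V : Type*} [NormedAddCommGroup V] [NormedSpace ℂ V] [FiniteDimensional ℂ V]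
  (ρ : Rep ℏ V)

theorem commute_K (a b : ℂ) : Commute (ρ.K a) (ρ.K b) := by
  rw [Commute, SemiconjBy, K_mul, K_mul, add_comm]

theorem hFall_eq (z : ℂ) (k : ℕ) : ρ.hFall z k =
    (((cpow ℏ (-1) - cpow ℏ 1) ^ k)⁻¹ * cpow ℏ (-(k * z + k * (k - 1) / 2))) •
      (qShift (cpow ℏ 2) (cpow ℏ (2 * z) • ρ.K 2) k * ρ.K (-k)) := by
  induction k with
  | zero => simp [hFall, qShift]
  | succ k ih =>
    have h1 : ρ.hNum (z - k) = ((cpow ℏ (-1) - cpow ℏ 1)⁻¹ * cpow ℏ (-(z + k))) •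
        ((cpow ℏ 2 ^ k • 1 - cpow ℏ (2 * z) • ρ.K 2) * ρ.K (-1)) := by
      have f1 : cpow ℏ (-(z - k)) = cpow ℏ (-(z + k)) * cpow ℏ 2 ^ k := by
        rw [← cpow_nat_mul, ← cpow_add]; congr 1; ring
      have f2 : cpow ℏ (z - k) = cpow ℏ (-(z + k)) * cpow ℏ (2 * z) := by
        rw [← cpow_add]; congr 1; ring
      rw [hNum, sub_mul, smul_one_mul, smul_mul_assoc, K_mul, ← neg_sub (cpow ℏ (-1)),
        inv_neg, f1, f2, show (2 : ℂ) + -1 = 1 by norm_num]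
      module
    have h2 : Commute (ρ.K (-1)) (qShift (cpow ℏ 2) (cpow ℏ (2 * z) • ρ.K 2) k) :=
      commute_qShift ((ρ.commute_K _ _).smul_right _) k
    have e1 : -(((k + 1 : ℕ) : ℂ) * z + (k + 1 : ℕ) * ((k + 1 : ℕ) - 1) / 2)
        = -(z + k) + -(k * z + k * (k - 1) / 2) := by push_cast; ring
    rw [hFall, ih, h1, qShift, e1, cpow_add, smul_mul_smul_comm, mul_assoc _ (ρ.K (-1)),
      ← mul_assoc (ρ.K (-1)),
      h2.eq, mul_assoc _ (ρ.K (-1)), K_mul, ← mul_assoc,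
      show -1 + -(k : ℂ) = -((k + 1 : ℕ) : ℂ) by push_cast; ring, pow_succ, mul_inv]
    congr 1
    ring

/-- The contribution to `M(x)` of the monomial `E_- ^ a E_+ ^ b` that arises from
`E_+ ^ (b + k) E_- ^ (a + k)`. -/
def MNormalTerm (x : ℂ) (a b k : ℕ) : V →L[ℂ] V :=
  ((-x) ^ (a + b) * cpow ℏ (a * b) /
      (numPoch (cpow ℏ 2) (cpow ℏ 2 * x ^ 2) b * qFact ℏ a * qFact ℏ b)) •
    (phiTerm (cpow ℏ 2) (cpow ℏ 2 * x ^ 2 * cpow ℏ 2 ^ b) (cpow ℏ (2 * (a - b)) • ρ.K 2) k *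
      (ρ.K ((a + b) / 2) * (ρ.Em ^ a * ρ.Ep ^ b)))

variable (hℏ : ‖cpow ℏ 1‖ < 1) {x : ℂ} (hx : x ≠ 0)
  (hC : ∀ i : ℕ, 1 - cpow ℏ 2 * x ^ 2 * cpow ℏ 2 ^ i ≠ 0)

include hℏ hx hC in
theorem MTerm_eq_sum (n m : ℕ) : ρ.MTerm x (n, m) =
    ∑ kb ∈ Finset.HasAntidiagonal.antidiagonal n,
      if kb.1 ≤ m then ρ.MNormalTerm x (m - kb.1) kb.2 kb.1 else 0 := by
  have h1 : ρ.Ep ^ n * ρ.Em ^ m * ρ.K (((n : ℂ) + m) / 2)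
      = cpow ℏ (2 * ((m : ℂ) - n) * ((n + m) / 2)) •
        (ρ.K (((n : ℂ) + m) / 2) * (ρ.Ep ^ n * ρ.Em ^ m)) := by
    rw [mul_assoc, Em_pow_mul_K, mul_smul_comm, ← mul_assoc, Ep_pow_mul_K, smul_mul_assoc,
      smul_smul, mul_assoc (ρ.K _), ← cpow_add]
    congr 2; ring
  rw [MTerm, ← K]
  dsimp only
  rw [h1, smul_smul, Ep_pow_mul_Em_pow ρ hℏ, Finset.mul_sum, Finset.smul_sum]
  refine Finset.sum_congr rfl fun ⟨k, b⟩ hkb => ?_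
  have hn : n = b + k := by rw [add_comm]; exact (Finset.HasAntidiagonal.mem_antidiagonal.1 hkb).symm
  dsimp only
  split_ifs with hk
  · obtain ⟨a, rfl⟩ := Nat.exists_eq_add_of_le' hk
    have h2 := MTerm_coeff_eq hℏ hx hC a b k n (a + k) hn rfl
    have h3 : qFall ℏ (a + k) k = qFact ℏ (a + k) / qFact ℏ a := by
      rw [← qFall_mul_qFact, mul_div_cancel_right₀ _ (qFact_ne_zero hℏ a)]
    have h4 : Commute (ρ.K (((n : ℂ) + (a + k : ℕ)) / 2))
        (qShift (cpow ℏ 2) (cpow ℏ (2 * ((a + k : ℕ) - n)) • ρ.K 2) k) :=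
      commute_qShift ((ρ.commute_K _ _).smul_right _) k
    rw [Nat.add_sub_cancel, MNormalTerm, phiTerm, smul_mul_assoc, smul_smul, ← h2, hFall_eq, h3,
      mul_smul_comm, smul_mul_assoc, mul_smul_comm, smul_smul, smul_smul, mul_assoc (qShift _ _ _),
      ← mul_assoc (ρ.K (_ / 2)), h4.eq, mul_assoc (qShift _ _ _), K_mul_assoc]
    have e1 : ((a + k : ℕ) : ℂ) - n = a - b := by rw [hn]; push_cast; ring
    have e2 : ((n : ℂ) + (a + k : ℕ)) / 2 + -k = (a + b) / 2 := by rw [hn]; push_cast; ring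
    rw [e2, e1]
    congr 1
    ring
  · rw [qFall_eq_zero (not_le.1 hk)]; simp

/-- Nilpotency of `E_±` leaves finitely many pairs `(a, b)`, and for each of them the series in `k`
is dominated by the `₁φ₁` series. -/
theorem summable_MNormalTerm (hℏ : ‖cpow ℏ 1‖ < 1) (x : ℂ) :
    Summable fun p : (ℕ × ℕ) × ℕ => ρ.MNormalTerm x p.1.1 p.1.2 p.2 := by
  have := FiniteDimensional.complete ℂ V
  obtain ⟨d₁, hd₁⟩ := ρ.exists_Em_pow_eq_zero
  obtain ⟨d₂, hd₂⟩ := ρ.exists_Ep_pow_eq_zero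
  have hQ := norm_cpow_two_lt_one hℏ
  refine Summable.of_norm ((summable_prod_of_nonneg fun _ => norm_nonneg _).2 ⟨fun ab => ?_, ?_⟩)
  · refine Summable.of_nonneg_of_le (fun _ => norm_nonneg _) (fun k => ?_)
      (((summable_norm_phiTerm hQ (cpow ℏ 2 * x ^ 2 * cpow ℏ 2 ^ ab.2)
        (cpow ℏ (2 * (ab.1 - ab.2)) • ρ.K 2)).mul_right
          ‖ρ.K ((ab.1 + ab.2) / 2) * (ρ.Em ^ ab.1 * ρ.Ep ^ ab.2)‖).mul_left
          ‖(-x) ^ (ab.1 + ab.2) * cpow ℏ (ab.1 * ab.2) /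
      (numPoch (cpow ℏ 2) (cpow ℏ 2 * x ^ 2) ab.2 * qFact ℏ ab.1 * qFact ℏ ab.2)‖)
    rw [MNormalTerm, norm_smul]
    gcongr
    exact norm_mul_le _ _
  · refine summable_of_ne_finset_zero (s := Finset.range d₁ ×ˢ Finset.range d₂) fun ab hab => ?_
    have h0 : ρ.Em ^ ab.1 * ρ.Ep ^ ab.2 = 0 := by
      simp only [Finset.mem_product, Finset.mem_range, not_and_or, not_lt] at hab
      rcases hab with h | h
      · rw [hd₁ _ h, zero_mul]
      · rw [hd₂ _ h, mul_zero]
    simp [MNormalTerm, h0]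

-- Rearrangement of an absolutely convergent triple series: the indices `(a, b, k)` are grouped
-- along the fibres `n = b + k`, `m = a + k`, each of which is finite.
include hℏ hx hC in
theorem hasSum_MTerm :
    HasSum (ρ.MTerm x) (∑' p : (ℕ × ℕ) × ℕ, ρ.MNormalTerm x p.1.1 p.1.2 p.2) := by
  have := FiniteDimensional.complete ℂ V
  let H : ℕ × (ℕ × ℕ) → (V →L[ℂ] V) := fun q =>
    if q.2.1 ≤ q.1 then ρ.MNormalTerm x (q.1 - q.2.1) q.2.2 q.2.1 else 0
  let i : (ℕ × ℕ) × ℕ → ℕ × (ℕ × ℕ) := fun p => (p.1.1 + p.2, (p.2, p.1.2))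
  have hi : Function.Injective i := by
    rintro ⟨⟨a, b⟩, k⟩ ⟨⟨a', b'⟩, k'⟩ h
    simp only [i, Prod.mk.injEq] at h ⊢
    omega
  have h1 : HasSum H (∑' p : (ℕ × ℕ) × ℕ, ρ.MNormalTerm x p.1.1 p.1.2 p.2) := by
    refine (hi.hasSum_iff ?_).1 ((ρ.summable_MNormalTerm hℏ x).hasSum.congr_fun fun p => ?_)
    · rintro ⟨m, k, b⟩ hq
      simp only [H]
      split_ifs with hk
      · exact (hq ⟨((m - k, b), k), by simp [i, hk]⟩).elim
      · rfl
    · simp [H, i]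
  refine (h1.tsum_fiberwise fun q => (q.2.1 + q.2.2, q.1)).congr_fun fun nm => ?_
  obtain ⟨n, m⟩ := nm
  have h2 : (fun q : ℕ × (ℕ × ℕ) => (q.2.1 + q.2.2, q.1)) ⁻¹' {(n, m)}
      = (((Finset.HasAntidiagonal.antidiagonal n).map
        ⟨fun kb => (m, kb), Prod.mk_right_injective m⟩ : Finset (ℕ × (ℕ × ℕ))) :
          Set (ℕ × (ℕ × ℕ))) := by
    ext ⟨m', k, b⟩
    simp [Finset.HasAntidiagonal.mem_antidiagonal]
    tauto
  rw [h2, Finset.tsum_subtype', Finset.sum_map, MTerm_eq_sum ρ hℏ hx hC]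
  rfl

-- For fixed `(a, b)` the `₁φ₁` parameter is `c = q² x² Q^b`. The part `(q² x²; Q)_b` of the scalar
-- product cancels the denominator, and the rest turns the sum over `k` into `(Q^a W; Q)_∞`.
include hℏ hx hC in
theorem qPochInf_mul_M : qPochInf (cpow ℏ 2) ((cpow ℏ 2 * x ^ 2) • (1 : V →L[ℂ] V)) * ρ.M x =
    ∑' ab : ℕ × ℕ, ((-x) ^ (ab.1 + ab.2) * cpow ℏ (ab.1 * ab.2) / (qFact ℏ ab.1 * qFact ℏ ab.2)) •
      (qPochInf (cpow ℏ 2) (cpow ℏ 2 ^ ab.1 • ρ.shiftedArg x) *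
        (ρ.K ((ab.1 + ab.2) / 2) * (ρ.Em ^ ab.1 * ρ.Ep ^ ab.2))) := by
  have := FiniteDimensional.complete ℂ V
  have hQ := norm_cpow_two_lt_one hℏ
  have hs := ρ.summable_MNormalTerm hℏ x
  rw [M, (ρ.hasSum_MTerm hℏ hx hC).tsum_eq, hs.tsum_prod, ← hs.prod.tsum_mul_left]
  refine tsum_congr fun ⟨a, b⟩ => ?_
  dsimp only
  have h1 : ∑' k, ρ.MNormalTerm x a b k = ((-x) ^ (a + b) * cpow ℏ (a * b) /
      (numPoch (cpow ℏ 2) (cpow ℏ 2 * x ^ 2) b * qFact ℏ a * qFact ℏ b)) •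
    ((∑' k, phiTerm (cpow ℏ 2) (cpow ℏ 2 * x ^ 2 * cpow ℏ 2 ^ b)
      (cpow ℏ (2 * (a - b)) • ρ.K 2) k) * (ρ.K ((a + b) / 2) * (ρ.Em ^ a * ρ.Ep ^ b))) := by
    have h2 := summable_phiTerm hQ (cpow ℏ 2 * x ^ 2 * cpow ℏ 2 ^ b)
      (cpow ℏ (2 * (a - b)) • ρ.K 2)
    rw [← h2.tsum_mul_right, ← (h2.mul_right _).tsum_const_smul]
    rfl
  have h3 : ∀ i : ℕ, 1 - cpow ℏ 2 * x ^ 2 * cpow ℏ 2 ^ b * cpow ℏ 2 ^ i ≠ 0 := by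
    intro i
    rw [mul_assoc _ (_ ^ b), ← pow_add]
    exact hC _
  have h4 : (cpow ℏ 2 * x ^ 2 * cpow ℏ 2 ^ b) • cpow ℏ (2 * (a - b)) • ρ.K 2
      = cpow ℏ 2 ^ a • ρ.shiftedArg x := by
    rw [shiftedArg, ← K, smul_smul, smul_smul, ← cpow_nat_mul, ← cpow_nat_mul]
    congr 1
    have : cpow ℏ (a * 2) = cpow ℏ (b * 2) * cpow ℏ (2 * (a - b)) := by
      rw [← cpow_add]; congr 1; ring
    rw [this]; ring
  rw [h1, qPochInf_smul_one_eq_numPoch_smul hQ _ b, mul_smul_comm, smul_mul_assoc, ← mul_assoc,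
    qPochInf_mul_tsum_phiTerm hQ h3, h4, smul_smul]
  congr 1
  have hb := numPoch_ne_zero hC b
  generalize numPoch (cpow ℏ 2) (cpow ℏ 2 * x ^ 2) b = P at *
  field_simp

end Rep

/-! ### The functional equation behind `N_-(x)`. -/

section

variable {V : Type*} [NormedAddCommGroup V] [NormedSpace ℂ V] [FiniteDimensional ℂ V]
  {ℏ : ℂ} (hℏ : ‖cpow ℏ 1‖ < 1)

-- Induction on `n` for all `W` at once. Multiplying by `(n+1)_{q⁻¹} = (b)_{q⁻¹} + q^(-2b)
-- (a)_{q⁻¹}` splits the sum into the case `n` for `W` and the case `n` for `Q W`, which combine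
-- through `(A; Q)_∞ = (1 - A)(Q A; Q)_∞`.
include hℏ in
theorem sum_antidiagonal_qPochInf (W : V →L[ℂ] V) (n : ℕ) :
    ∑ ab ∈ Finset.HasAntidiagonal.antidiagonal n,
      ((-1) ^ ab.1 * cpow ℏ (-(ab.1 * (ab.1 - 1))) / (pFact (-ℏ) ab.1 * pFact (-ℏ) ab.2)) •
        qPochInf (cpow ℏ 2) (cpow ℏ 2 ^ ab.1 • W)
    = ((-1) ^ n * cpow ℏ (n * (n - 1)) / pFact (-ℏ) n) •
        (qPochInf (cpow ℏ 2) (cpow ℏ 2 ^ n • W) * W ^ n) := by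
  have hQ := norm_cpow_two_lt_one hℏ
  induction n generalizing W with
  | zero => simp
  | succ n ih =>
    let F : ℕ × ℕ → (V →L[ℂ] V) := fun ab =>
      ((-1) ^ ab.1 * cpow ℏ (-(ab.1 * (ab.1 - 1))) / (pFact (-ℏ) ab.1 * pFact (-ℏ) ab.2)) •
        qPochInf (cpow ℏ 2) (cpow ℏ 2 ^ ab.1 • W)
    have hn : ∀ m : ℕ, pNum (-ℏ) ((m : ℂ) + 1) ≠ 0 := by
      intro m h
      have := pFact_neg_ne_zero hℏ (m + 1)
      rw [pFact_succ, h, mul_zero] at this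
      exact this rfl
    have h0 : pNum (-ℏ) 0 = 0 := by simp [pNum]
    have h1 : pNum (-ℏ) ((n : ℂ) + 1) • ∑ ab ∈ Finset.HasAntidiagonal.antidiagonal (n + 1), F ab
        = ∑ ab ∈ Finset.HasAntidiagonal.antidiagonal (n + 1), pNum (-ℏ) ab.2 • F ab +
          ∑ ab ∈ Finset.HasAntidiagonal.antidiagonal (n + 1),
            (cpow ℏ (-(2 * ab.2)) * pNum (-ℏ) ab.1) • F ab := by
      rw [Finset.smul_sum, ← Finset.sum_add_distrib]
      refine Finset.sum_congr rfl fun ⟨a, b⟩ hab => ?_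
      have hab' : (n : ℂ) + 1 = a + b := by
        exact_mod_cast (Finset.HasAntidiagonal.mem_antidiagonal.1 hab).symm
      rw [hab', pNum_add, ← add_smul, cpow_base_neg]
    have h2 : ∑ ab ∈ Finset.HasAntidiagonal.antidiagonal (n + 1), pNum (-ℏ) ab.2 • F ab
        = ((-1) ^ n * cpow ℏ (n * (n - 1)) / pFact (-ℏ) n) •
        (qPochInf (cpow ℏ 2) (cpow ℏ 2 ^ n • W) * W ^ n) := by
      rw [← ih, Finset.Nat.sum_antidiagonal_succ']
      simp only [Nat.cast_zero, h0, zero_smul, zero_add]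
      refine Finset.sum_congr rfl fun ⟨a, b⟩ hab => ?_
      simp only [F, smul_smul]
      congr 1
      have := hn b
      push_cast
      rw [pFact_succ]
      have := pFact_neg_ne_zero hℏ a
      have := pFact_neg_ne_zero hℏ b
      field_simp
    have h3 : ∑ ab ∈ Finset.HasAntidiagonal.antidiagonal (n + 1),
          (cpow ℏ (-(2 * ab.2)) * pNum (-ℏ) ab.1) • F ab
        = -(cpow ℏ (-(2 * n)) • ((-1) ^ n * cpow ℏ (n * (n - 1)) / pFact (-ℏ) n) •
        (qPochInf (cpow ℏ 2) (cpow ℏ 2 ^ n • cpow ℏ 2 • W) * (cpow ℏ 2 • W) ^ n)) := by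
      rw [← ih, Finset.Nat.sum_antidiagonal_succ]
      simp only [Nat.cast_zero, h0, mul_zero, zero_smul, zero_add]
      rw [← smul_neg, ← Finset.sum_neg_distrib, Finset.smul_sum]
      refine Finset.sum_congr rfl fun ⟨a, b⟩ hab => ?_
      have hab' : (n : ℂ) = a + b := by
        exact_mod_cast (Finset.HasAntidiagonal.mem_antidiagonal.1 hab).symm
      simp only [F, smul_smul, ← neg_smul, ← pow_succ]
      congr 1
      have := hn a
      have e : cpow ℏ (-(2 * b)) * cpow ℏ (-(((a + 1 : ℕ) : ℂ) * ((a + 1 : ℕ) - 1)))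
          = cpow ℏ (-(2 * n)) * cpow ℏ (-(a * (a - 1))) := by
        rw [← cpow_add, ← cpow_add, hab']; congr 1; push_cast; ring
      push_cast at e ⊢
      rw [pFact_succ, pow_succ]
      have h4 := pFact_neg_ne_zero hℏ a
      have h5 := pFact_neg_ne_zero hℏ b
      field_simp
      linear_combination (-1) * e
    have h4 : qPochInf (cpow ℏ 2) (cpow ℏ 2 ^ n • W) = qPochInf (cpow ℏ 2) (cpow ℏ 2 ^ (n + 1) • W)
        * (1 - cpow ℏ 2 ^ n • W) := by
      have hc : Commute (1 - cpow ℏ 2 ^ n • W) (qPochInf (cpow ℏ 2) (cpow ℏ 2 ^ (n + 1) • W)) :=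
        commute_qPochInf hQ ((Commute.one_left _).sub_left
          (((Commute.refl W).smul_left _).smul_right _))
      rw [qPochInf_eq_mul hQ, smul_smul, ← pow_succ', hc.eq]
    have e1 : cpow ℏ (-(2 * n)) * cpow ℏ 2 ^ n = 1 := by
      rw [← cpow_nat_mul, ← cpow_add, ← cpow_zero ℏ]; congr 1; ring
    have e2 : cpow ℏ (((n + 1 : ℕ) : ℂ) * ((n + 1 : ℕ) - 1))
        = cpow ℏ (n * (n - 1)) * cpow ℏ 2 ^ n := by
      rw [← cpow_nat_mul, ← cpow_add]; congr 1; push_cast; ring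
    have h5 := hn n
    have h6 := pFact_neg_ne_zero hℏ n
    refine (smul_right_injective _ h5).eq_iff.1 ?_
    change pNum (-ℏ) ((n : ℂ) + 1) • ∑ ab ∈ Finset.HasAntidiagonal.antidiagonal (n + 1), F ab = _
    rw [h1, h2, h3, smul_smul (cpow ℏ 2 ^ n), ← pow_succ, h4, smul_pow, e2, pFact_succ, pow_succ W]
    simp only [mul_smul_comm, mul_sub, sub_mul, mul_one, smul_mul_assoc, smul_smul, mul_assoc]
    rw [← pow_succ, ← pow_succ', pow_succ (-1 : ℂ)]
    generalize cpow ℏ (-(2 * n)) = t at *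
    match_scalars
    · field_simp
      linear_combination (-(cpow ℏ (n * (n - 1)) * (-1) ^ n)) * e1
    · field_simp

/-- The general term of `∑ (-1) ^ n q ^ (n (n - 1)) / (n)_{q⁻¹}! (q ^ (2n) W; q²)_∞ W ^ n Z ^ n`. -/
def lowerTerm (ℏ : ℂ) (W Z : V →L[ℂ] V) (n : ℕ) : V →L[ℂ] V :=
  ((-1) ^ n * cpow ℏ (n * (n - 1)) / pFact (-ℏ) n) •
    (qPochInf (cpow ℏ 2) (cpow ℏ 2 ^ n • W) * W ^ n * Z ^ n)

theorem summable_norm_of_eq_zero {E : Type*} [NormedAddCommGroup E] {g : ℕ → E} {d : ℕ}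
    (h : ∀ n, d ≤ n → g n = 0) : Summable fun n => ‖g n‖ :=
  summable_of_ne_finset_zero (s := Finset.range d) fun n hn => by
    rw [h n (by simpa using hn), norm_zero]

theorem mul_pow_of_mul_eq_smul {R Z : V →L[ℂ] V} (h : Z * R = cpow ℏ (-4) • (R * Z)) (n : ℕ) :
    (R * Z) ^ n = cpow ℏ (-(2 * (n * (n - 1)))) • (R ^ n * Z ^ n) := by
  have h1 : ∀ n : ℕ, Z ^ n * R = cpow ℏ (-(4 * n)) • (R * Z ^ n) := by
    intro n
    induction n with
    | zero => simp
    | succ n ih =>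
      rw [pow_succ, mul_assoc, h, mul_smul_comm, ← mul_assoc, ih, smul_mul_assoc, smul_smul,
        mul_assoc R, ← cpow_add]
      congr 2; push_cast; ring
  induction n with
  | zero => simp
  | succ n ih =>
    rw [pow_succ, ih, smul_mul_assoc, mul_assoc, ← mul_assoc (Z ^ n), h1, smul_mul_assoc,
      mul_smul_comm, smul_smul, mul_assoc R, ← mul_assoc (R ^ n), ← pow_succ, ← pow_succ,
      ← cpow_add]
    congr 2; push_cast; ring

-- Here `R = W⁻¹`, so `W^n (RZ)^n` is a scalar multiple of `Z^n`. The right side is then a Cauchy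
-- product in powers of `Z`, whose coefficients are those of `sum_antidiagonal_qPochInf`.
include hℏ in
theorem tsum_lowerTerm_eq_mul_qExp {W R Z : V →L[ℂ] V} (hWR : W * R = 1) (hRW : R * W = 1)
    (h : Z * R = cpow ℏ (-4) • (R * Z)) {d : ℕ} (hd : ∀ n, d ≤ n → Z ^ n = 0) :
    ∑' n, lowerTerm ℏ W Z n = (∑' n, lowerTerm ℏ W (R * Z) n) * qExp (-ℏ) Z := by
  have := FiniteDimensional.complete ℂ V
  have h1 : ∀ n, lowerTerm ℏ W (R * Z) n = ((-1) ^ n * cpow ℏ (-(n * (n - 1))) / pFact (-ℏ) n) •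
      (qPochInf (cpow ℏ 2) (cpow ℏ 2 ^ n • W) * Z ^ n) := by
    intro n
    have hc : Commute W R := hWR.trans hRW.symm
    rw [lowerTerm, mul_pow_of_mul_eq_smul h, mul_smul_comm, mul_assoc (qPochInf _ _) (W ^ n),
      ← mul_assoc (W ^ n), ← hc.mul_pow, hWR, one_pow, one_mul, smul_smul]
    have e : cpow ℏ (-(n * (n - 1))) = cpow ℏ (n * (n - 1)) * cpow ℏ (-(2 * (n * (n - 1)))) := by
      rw [← cpow_add]; congr 1; ring
    rw [e]
    congr 1
    ring
  have s1 : Summable fun n => ‖lowerTerm ℏ W (R * Z) n‖ :=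
    summable_norm_of_eq_zero (d := d) fun n hn => by rw [h1, hd n hn, mul_zero, smul_zero]
  have s2 : Summable fun n => ‖qExpTerm (-ℏ) Z n‖ :=
    summable_norm_of_eq_zero (d := d) fun n hn => by rw [qExpTerm, hd n hn, smul_zero]
  rw [qExp, tsum_mul_tsum_eq_tsum_sum_antidiagonal_of_summable_norm s1 s2]
  refine tsum_congr fun n => ?_
  rw [lowerTerm, ← smul_mul_assoc, ← sum_antidiagonal_qPochInf hℏ, Finset.sum_mul]
  refine Finset.sum_congr rfl fun ⟨a, b⟩ hab => ?_
  rw [h1, qExpTerm, smul_mul_smul_comm, mul_assoc, ← pow_add,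
    Finset.HasAntidiagonal.mem_antidiagonal.1 hab, smul_mul_assoc]
  congr 1
  rw [div_mul_eq_mul_div, ← div_div, div_eq_mul_inv _ (pFact (-ℏ) b)]
  ring

end

/-! ### The normally ordered form of `N(x)`. -/

namespace Rep

variable {ℏ : ℂ} {V : Type*} [NormedAddCommGroup V] [NormedSpace ℂ V] [FiniteDimensional ℂ V]
  (ρ : Rep ℏ V)

theorem f_eq : ρ.f = cpow ℏ (-1) • (ρ.K (-1 / 2) * ρ.Em) := by
  rw [f, ← K, Em_mul_K]
  congr 2; ring

theorem NminusArg_eq (x : ℂ) (k : ℕ) : ρ.NminusArg x k =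
    ((x ^ (2 * k + 1))⁻¹ * cpow ℏ (-(2 * k + 2))) • (ρ.K (-(2 * k + 3 / 2)) * ρ.Em) := by
  rw [NminusArg, opPow_smul_add_one, f_eq, smul_mul_smul_comm, K_mul_assoc, smul_smul, ← cpow_add]
  congr 3
  · ring_nf
  · ring

/-- The inverse of the operator `q² x² q ^ (2h)`. -/
def shiftedArgInv (x : ℂ) : V →L[ℂ] V := (cpow ℏ 2 * x ^ 2)⁻¹ • ρ.K (-2)

theorem shiftedArg_eq (x : ℂ) : ρ.shiftedArg x = (cpow ℏ 2 * x ^ 2) • ρ.K 2 := rfl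

theorem shiftedArg_mul_inv {x : ℂ} (hx : x ≠ 0) : ρ.shiftedArg x * ρ.shiftedArgInv x = 1 := by
  have : cpow ℏ 2 * x ^ 2 ≠ 0 := mul_ne_zero (cpow_ne_zero _ _) (pow_ne_zero _ hx)
  rw [shiftedArg_eq, shiftedArgInv, smul_mul_smul_comm, K_mul, mul_inv_cancel₀ this]
  simp

theorem shiftedArg_inv_mul {x : ℂ} (hx : x ≠ 0) : ρ.shiftedArgInv x * ρ.shiftedArg x = 1 := by
  have : cpow ℏ 2 * x ^ 2 ≠ 0 := mul_ne_zero (cpow_ne_zero _ _) (pow_ne_zero _ hx)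
  rw [shiftedArg_eq, shiftedArgInv, smul_mul_smul_comm, K_mul, inv_mul_cancel₀ this]
  simp

theorem NminusArg_succ (x : ℂ) (k : ℕ) :
    ρ.NminusArg x (k + 1) = ρ.shiftedArgInv x * ρ.NminusArg x k := by
  rw [NminusArg_eq, NminusArg_eq, shiftedArgInv, smul_mul_smul_comm, K_mul_assoc, mul_inv,
    ← cpow_neg]
  have e : cpow ℏ (-(2 * (k + 1 : ℕ) + 2)) = cpow ℏ (-2) * cpow ℏ (-(2 * k + 2)) := by
    rw [← cpow_add]; congr 1; push_cast; ring
  rw [e]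
  congr 1
  · rw [show 2 * (k + 1) + 1 = 2 + (2 * k + 1) by ring, pow_add, mul_inv]; ring
  · congr 2; push_cast; ring

theorem NminusArg_mul_shiftedArgInv (x : ℂ) (k : ℕ) :
    ρ.NminusArg x k * ρ.shiftedArgInv x
      = cpow ℏ (-4) • (ρ.shiftedArgInv x * ρ.NminusArg x k) := by
  rw [NminusArg_eq, shiftedArgInv, smul_mul_smul_comm, smul_mul_smul_comm,
    mul_assoc (ρ.K _) ρ.Em, Em_mul_K,
    K_mul_assoc, mul_smul_comm, K_mul_assoc, smul_smul, smul_smul, add_comm (-2 : ℂ)]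
  congr 1
  rw [show (2 : ℂ) * -2 = -4 by norm_num]
  ring

theorem exists_NminusArg_pow_eq_zero (x : ℂ) :
    ∃ d : ℕ, ∀ k n, d ≤ n → ρ.NminusArg x k ^ n = 0 := by
  obtain ⟨d, hd⟩ := ρ.exists_Em_pow_eq_zero
  refine ⟨d, fun k n hn => ?_⟩
  rw [NminusArg_eq, smul_pow, K_mul_Em_pow, hd n hn]
  simp

variable (hℏ : ‖cpow ℏ 1‖ < 1) {x : ℂ} (hx : x ≠ 0)

include hℏ hx

theorem tsum_lowerTerm_NminusArg (k : ℕ) :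
    ∑' n, lowerTerm ℏ (ρ.shiftedArg x) (ρ.NminusArg x 0) n =
      (∑' n, lowerTerm ℏ (ρ.shiftedArg x) (ρ.NminusArg x k) n) * ρ.NminusPartial x k := by
  obtain ⟨d, hd⟩ := ρ.exists_NminusArg_pow_eq_zero x
  induction k with
  | zero => simp [NminusPartial]
  | succ k ih =>
    rw [ih, tsum_lowerTerm_eq_mul_qExp hℏ (ρ.shiftedArg_mul_inv hx) (ρ.shiftedArg_inv_mul hx)
      (ρ.NminusArg_mul_shiftedArgInv x k) (hd k), NminusPartial, NminusArg_succ, mul_assoc]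

theorem qPochInf_mul_Nminus (hX : Tendsto (ρ.NminusArg x) atTop (𝓝 0))
    (hN : Tendsto (ρ.NminusPartial x) atTop (𝓝 (ρ.Nminus x))) :
    qPochInf (cpow ℏ 2) (ρ.shiftedArg x) * ρ.Nminus x =
      ∑' n, lowerTerm ℏ (ρ.shiftedArg x) (ρ.NminusArg x 0) n := by
  obtain ⟨d, hd⟩ := ρ.exists_NminusArg_pow_eq_zero x
  have h1 : Tendsto (fun k => ∑' n, lowerTerm ℏ (ρ.shiftedArg x) (ρ.NminusArg x k) n) atTop
      (𝓝 (qPochInf (cpow ℏ 2) (ρ.shiftedArg x))) := by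
    -- The nilpotency bound `d` is uniform in `k`, so the series is one fixed polynomial in its
    -- argument and the limit `Z → 0` may be taken by continuity.
    have h2 : ∀ k, ∑' n, lowerTerm ℏ (ρ.shiftedArg x) (ρ.NminusArg x k) n
        = ∑ n ∈ Finset.range (d + 1), lowerTerm ℏ (ρ.shiftedArg x) (ρ.NminusArg x k) n := by
      intro k
      refine tsum_eq_sum fun n hn => ?_
      rw [lowerTerm, hd k n (by simp at hn; omega), mul_zero, smul_zero]
    simp only [h2]
    have h3 : Continuous fun Z => ∑ n ∈ Finset.range (d + 1), lowerTerm ℏ (ρ.shiftedArg x) Z n := by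
      unfold lowerTerm
      fun_prop
    have h4 := (h3.tendsto 0).comp hX
    rw [Finset.sum_range_succ'] at h4
    simpa [lowerTerm, Function.comp_def] using h4
  refine tendsto_nhds_unique (h1.mul hN) (tendsto_const_nhds.congr fun k => ?_)
  exact ρ.tsum_lowerTerm_NminusArg hℏ hx k

theorem qPochInf_mul_N (hX : Tendsto (ρ.NminusArg x) atTop (𝓝 0))
    (hN : Tendsto (ρ.NminusPartial x) atTop (𝓝 (ρ.Nminus x))) :
    qPochInf (cpow ℏ 2) (ρ.shiftedArg x) * ρ.N x =
    ∑' ab : ℕ × ℕ, ((-x) ^ (ab.1 + ab.2) * cpow ℏ (ab.1 * ab.2) / (qFact ℏ ab.1 * qFact ℏ ab.2)) •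
      (qPochInf (cpow ℏ 2) (cpow ℏ 2 ^ ab.1 • ρ.shiftedArg x) *
        (ρ.K ((ab.1 + ab.2) / 2) * (ρ.Em ^ ab.1 * ρ.Ep ^ ab.2))) := by
  have := FiniteDimensional.complete ℂ V
  obtain ⟨d, hd⟩ := ρ.exists_NminusArg_pow_eq_zero x
  obtain ⟨d', hd'⟩ := ρ.exists_Ep_pow_eq_zero
  have he : ∀ b : ℕ, (-x • ρ.e) ^ b
      = ((-x) ^ b * cpow ℏ (-(b * (b - 1) / 2))) • (ρ.K (b / 2) * ρ.Ep ^ b) := by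
    intro b
    rw [e, ← K, smul_pow, K_mul_Ep_pow, smul_smul]
    congr 3 <;> ring_nf
  have hZ : ∀ a : ℕ, ρ.shiftedArg x ^ a * ρ.NminusArg x 0 ^ a
      = (x ^ a * cpow ℏ (-(3 / 2 * (a * (a - 1))))) • (ρ.K (a / 2) * ρ.Em ^ a) := by
    intro a
    rw [NminusArg_eq, shiftedArg_eq, smul_pow, smul_pow, K_mul_Em_pow, K_pow, smul_smul,
      smul_mul_smul_comm, K_mul_assoc]
    have e1 : cpow ℏ (-(2 * (0 : ℕ) + 2)) = (cpow ℏ 2)⁻¹ := by rw [← cpow_neg]; simp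
    rw [e1]
    congr 1
    · have := cpow_ne_zero ℏ 2
      rw [show -(2 * ((0 : ℕ) : ℂ) + 3 / 2) * (a * (a - 1)) = -(3 / 2 * (a * (a - 1))) by
        push_cast; ring]
      simp only [mul_pow, inv_pow, mul_zero, zero_add, pow_one]
      field_simp
      ring
    · congr 2; push_cast; ring
  have s1 : Summable fun n => ‖lowerTerm ℏ (ρ.shiftedArg x) (ρ.NminusArg x 0) n‖ :=
    summable_norm_of_eq_zero (d := d) fun n hn => by
      rw [lowerTerm, hd 0 n hn, mul_zero, smul_zero]
  have s2 : Summable fun n => ‖qExpTerm (-ℏ) (-x • ρ.e) n‖ :=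
    summable_norm_of_eq_zero (d := d') fun n hn => by
      rw [qExpTerm, he, hd' n hn, mul_zero, smul_zero, smul_zero]
  rw [N, ← mul_assoc, ρ.qPochInf_mul_Nminus hℏ hx hX hN, Nplus, qExp,
    tsum_mul_tsum_of_summable_norm s1 s2]
  refine tsum_congr fun ⟨a, b⟩ => ?_
  dsimp only
  rw [lowerTerm, qExpTerm, he, mul_assoc (qPochInf _ _), hZ, smul_smul, smul_mul_smul_comm,
    mul_smul_comm, smul_mul_assoc, smul_smul, mul_assoc (qPochInf _ _), mul_assoc (ρ.K _),
    ← mul_assoc (ρ.Em ^ a), Em_pow_mul_K, smul_mul_assoc, mul_smul_comm, mul_smul_comm, smul_smul,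
    mul_assoc (ρ.K (b / 2)), K_mul_assoc, ← add_div, pFact_eq, pFact_eq, qFact_base_neg,
    qFact_base_neg, cpow_base_neg, cpow_base_neg]
  congr 1
  have fa := qFact_ne_zero hℏ a
  have fb := qFact_ne_zero hℏ b
  have e1 : cpow ℏ (-(3 / 2 * (a * (a - 1))))
      = cpow ℏ (-((a : ℂ) * (a - 1) / 2)) * (cpow ℏ (a * (a - 1)))⁻¹ := by
    rw [← cpow_neg, ← cpow_add]; congr 1; ring
  have h1 := cpow_ne_zero ℏ (-((a : ℂ) * (a - 1) / 2))
  have h2 := cpow_ne_zero ℏ ((a : ℂ) * (a - 1))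
  have h3 := cpow_ne_zero ℏ (-((b : ℂ) * (b - 1) / 2))
  rw [e1, show (2 : ℂ) * a * (b / 2) = a * b by ring, pow_add, neg_pow x a]
  field_simp

end Rep

/-! ### Spectral estimates and convergence of `N_-(x)`. -/

/-- By Gelfand's formula the powers are eventually dominated by a geometric sequence of ratio less
than `1`. -/
theorem summable_norm_pow_of_forall_spectrum {A : Type*} [NormedRing A] [NormedAlgebra ℂ A]
    [CompleteSpace A] [Nontrivial A] {a : A} (h : ∀ z ∈ spectrum ℂ a, ‖z‖ < 1) :
    Summable fun n : ℕ => ‖a ^ n‖ := by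
  have h1 : spectralRadius ℂ a < (1 : NNReal) :=
    spectrum.spectralRadius_lt_of_forall_lt a fun z hz => h z hz
  obtain ⟨r, hr1, hr2⟩ := ENNReal.lt_iff_exists_nnreal_btwn.1 h1
  have h2 := (spectrum.pow_nnnorm_pow_one_div_tendsto_nhds_spectralRadius a).eventually
    (gt_mem_nhds hr1)
  have hr : (r : ℝ) < 1 := by exact_mod_cast hr2
  refine Summable.of_norm_bounded_eventually_nat
    (summable_geometric_of_lt_one r.coe_nonneg hr) ?_
  filter_upwards [h2, eventually_gt_atTop 0] with n hn hn0
  have h3 : ((‖a ^ n‖₊ : ENNReal) ^ (1 / n : ℝ)) ^ (n : ℝ) ≤ (r : ENNReal) ^ (n : ℝ) :=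
    ENNReal.rpow_le_rpow hn.le n.cast_nonneg
  rw [← ENNReal.rpow_mul, one_div_mul_cancel (by positivity), ENNReal.rpow_one,
    ENNReal.rpow_natCast] at h3
  rw [norm_norm]
  exact_mod_cast h3

section FiniteDimensional

variable {V : Type*} [NormedAddCommGroup V] [NormedSpace ℂ V] [FiniteDimensional ℂ V]

theorem isUnit_of_injective {T : V →L[ℂ] V} (h : ∀ v, T v = 0 → v = 0) : IsUnit T := by
  have := FiniteDimensional.complete ℂ V
  have h1 : Function.Injective T := (injective_iff_map_eq_zero T).2 h
  rw [ContinuousLinearMap.isUnit_iff_bijective]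
  exact ⟨h1, (LinearMap.injective_iff_surjective (f := (T : V →ₗ[ℂ] V))).1 h1⟩

theorem exists_eigenvector_mem (T : V →L[ℂ] V) {E : Submodule ℂ V} (hT : ∀ v ∈ E, T v ∈ E)
    {v : V} (hv : v ∈ E) (hv0 : v ≠ 0) : ∃ w ∈ E, w ≠ 0 ∧ ∃ μ : ℂ, T w = μ • w := by
  have : Nontrivial E := ⟨⟨v, hv⟩, 0, fun h => hv0 (congrArg Subtype.val h)⟩
  obtain ⟨μ, hμ⟩ := Module.End.exists_eigenvalue ((T : V →ₗ[ℂ] V).restrict hT)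
  obtain ⟨w, hw⟩ := hμ.exists_hasEigenvector
  refine ⟨w, w.2, fun h => hw.2 (Subtype.ext h), μ, ?_⟩
  exact congrArg Subtype.val hw.apply_eq_smul

theorem hasEigenvalue_of_apply_eq {T : V →L[ℂ] V} {v : V} {μ : ℂ} (h : T v = μ • v) (hv : v ≠ 0) :
    Module.End.HasEigenvalue (T : V →ₗ[ℂ] V) μ :=
  Module.End.hasEigenvalue_of_hasEigenvector ⟨Module.End.mem_eigenspace_iff.2 h, hv⟩

theorem summable_norm_pow_mul_of_intertwine {U : Type*} [NormedAddCommGroup U] [NormedSpace ℂ U]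
    [FiniteDimensional ℂ U] {T : V →L[ℂ] V} {S : U →L[ℂ] U} (i : U →L[ℂ] V) (p : V →L[ℂ] U)
    (hT : T.comp i = i.comp S) (h : ∀ (z : ℂ) (u : U), u ≠ 0 → S u = z • u → ‖z‖ < 1) :
    Summable fun n : ℕ => ‖T ^ n * i.comp p‖ := by
  have := FiniteDimensional.complete ℂ U
  have h1 : ∀ n : ℕ, (T ^ n).comp i = i.comp (S ^ n) := by
    intro n
    induction n with
    | zero => rfl
    | succ n ih =>
      rw [pow_succ', pow_succ']
      change T.comp ((T ^ n).comp i) = (i.comp S).comp (S ^ n)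
      rw [ih, ← hT]
      rfl
  have h2 : ∀ n : ℕ, T ^ n * i.comp p = i.comp ((S ^ n).comp p) := by
    intro n
    change ((T ^ n).comp i).comp p = _
    rw [h1]
    rfl
  rcases subsingleton_or_nontrivial U with hs | hs
  · refine summable_zero.congr fun n => ?_
    have : p = 0 := by ext v; exact Subsingleton.elim _ _
    simp [this]
  · have h3 : Summable fun n : ℕ => ‖S ^ n‖ := by
      refine summable_norm_pow_of_forall_spectrum fun z hz => ?_
      by_contra hz1
      refine hz (isUnit_of_injective fun u hu => ?_)
      by_contra hu0
      have h3 : z • u - S u = 0 := hu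
      exact hz1 (h z u hu0 (sub_eq_zero.1 h3).symm)
    refine Summable.of_nonneg_of_le (fun _ => norm_nonneg _) (fun n => ?_)
      ((h3.mul_left ‖i‖).mul_right ‖p‖)
    rw [h2, mul_assoc]
    exact (ContinuousLinearMap.opNorm_comp_le _ _).trans
      (mul_le_mul_of_nonneg_left (ContinuousLinearMap.opNorm_comp_le _ _) (norm_nonneg _))

/-- The relation `hA` makes the range of `A` stable under `T`, so only the eigenvalues of `T` on
that range matter. -/
theorem summable_norm_pow_mul {T A B : V →L[ℂ] V} (hA : T * A = A * B)
    (h : ∀ (z : ℂ) (v : V), v ∈ LinearMap.range (A : V →ₗ[ℂ] V) → v ≠ 0 → T v = z • v → ‖z‖ < 1) :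
    Summable fun n : ℕ => ‖T ^ n * A‖ := by
  have hU : ∀ v ∈ LinearMap.range (A : V →ₗ[ℂ] V), T v ∈ LinearMap.range (A : V →ₗ[ℂ] V) := by
    rintro _ ⟨w, rfl⟩
    exact ⟨B w, (congrArg (fun S : V →L[ℂ] V => S w) hA).symm⟩
  exact summable_norm_pow_mul_of_intertwine
    (S := LinearMap.toContinuousLinearMap ((T : V →ₗ[ℂ] V).restrict hU))
    (LinearMap.range (A : V →ₗ[ℂ] V)).subtypeL
    (LinearMap.toContinuousLinearMap (LinearMap.rangeRestrict (A : V →ₗ[ℂ] V))) rfl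
    fun z u hu0 hu => h z u u.2 (fun h0 => hu0 (Subtype.ext h0)) (congrArg Subtype.val hu)

end FiniteDimensional

namespace Rep

variable {ℏ : ℂ} {V : Type*} [NormedAddCommGroup V] [NormedSpace ℂ V] [FiniteDimensional ℂ V]
  (ρ : Rep ℏ V)

/-- A preimage of `v` under `E_-` need not be an eigenvector. Instead, if `h - (μ + 2)` were
invertible, then `(h - μ) E_- = E_- (h - μ - 2)` would make `h - μ` surjective, hence injective, on
the range of `E_-`. -/
theorem hasEigenvalue_add_two {v : V} {μ : ℂ} (hv : v ∈ LinearMap.range (ρ.Em : V →ₗ[ℂ] V))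
    (hv0 : v ≠ 0) (h : ρ.h v = μ • v) :
    Module.End.HasEigenvalue (ρ.h : V →ₗ[ℂ] V) (μ + 2) := by
  by_contra hμ
  let T : V →ₗ[ℂ] V := (ρ.h : V →ₗ[ℂ] V) - (μ + 2) • LinearMap.id
  have hT : Function.Injective T := by
    refine (injective_iff_map_eq_zero T).2 fun w hw => ?_
    by_contra hw0
    exact hμ (hasEigenvalue_of_apply_eq (sub_eq_zero.1 hw) hw0)
  have hT' := LinearMap.injective_iff_surjective.1 hT
  let S : V →ₗ[ℂ] V := (ρ.h : V →ₗ[ℂ] V) - μ • LinearMap.id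
  have hS : ∀ w, S (ρ.Em w) = ρ.Em (T w) := by
    intro w
    have h1 : ρ.h (ρ.Em w) - ρ.Em (ρ.h w) = (-2 : ℂ) • ρ.Em w :=
      congrArg (fun A : V →L[ℂ] V => A w) ρ.h_Em
    change ρ.h (ρ.Em w) - μ • ρ.Em w = ρ.Em (ρ.h w - (μ + 2) • w)
    rw [map_sub, map_smul, sub_eq_iff_eq_add.1 h1]
    module
  let U := LinearMap.range (ρ.Em : V →ₗ[ℂ] V)
  have hU : ∀ w ∈ U, S w ∈ U := by
    rintro _ ⟨w, rfl⟩
    exact ⟨T w, (hS w).symm⟩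
  have hsurj : Function.Surjective (S.restrict hU) := by
    rintro ⟨_, w, rfl⟩
    obtain ⟨w', rfl⟩ := hT' w
    exact ⟨⟨ρ.Em w', w', rfl⟩, Subtype.ext (hS w')⟩
  have hinj := LinearMap.injective_iff_surjective.2 hsurj
  have h2 : S.restrict hU ⟨v, hv⟩ = 0 := Subtype.ext (sub_eq_zero.2 h)
  exact hv0 (congrArg Subtype.val ((injective_iff_map_eq_zero _).1 hinj _ h2))

theorem K_apply {v : V} {μ : ℂ} (h : ρ.h v = μ • v) (z : ℂ) : ρ.K z v = cpow ℏ (z * μ) • v :=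
  opPow_smul_apply h z

theorem commute_h_K (z : ℂ) : Commute ρ.h (ρ.K z) := by
  have := FiniteDimensional.complete ℂ V
  exact (((Commute.refl ρ.h).smul_right z).smul_right ℏ).exp_right

section

variable {x : ℂ} (hx : x ≠ 0)
    (hlarge : ∀ μ : ℂ, Module.End.HasEigenvalue (ρ.h : V →ₗ[ℂ] V) μ →
      Module.End.HasEigenvalue (ρ.h : V →ₗ[ℂ] V) (μ + 2) →
      1 < ‖x * cpow ℏ (μ + 1)‖)

include hx hlarge

theorem summable_norm_NminusArg : Summable fun k => ‖ρ.NminusArg x k‖ := by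
  let c := x⁻¹ * cpow ℏ (-1)
  have hc : c ≠ 0 := mul_ne_zero (inv_ne_zero hx) (cpow_ne_zero _ _)
  have h1 : Summable fun n : ℕ => ‖(c • ρ.K (-1)) ^ n * ρ.Em‖ := by
    refine summable_norm_pow_mul (B := (c * (cpow ℏ (2 * -1))⁻¹) • ρ.K (-1)) ?_ fun z v hv hv0 hz => ?_
    · rw [mul_smul_comm, Em_mul_K, smul_smul, smul_mul_assoc,
        inv_mul_cancel_right₀ (cpow_ne_zero _ _)]
    · let E : Submodule ℂ V := LinearMap.range (ρ.Em : V →ₗ[ℂ] V) ⊓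
        LinearMap.ker ((c • ρ.K (-1) - z • (1 : V →L[ℂ] V) : V →L[ℂ] V) : V →ₗ[ℂ] V)
      have hE : ∀ w ∈ E, ρ.h w ∈ E := by
        rintro w ⟨⟨w', rfl⟩, hw⟩
        refine ⟨⟨ρ.h w' - (2 : ℂ) • w', ?_⟩, ?_⟩
        · have h1 : ρ.h (ρ.Em w') - ρ.Em (ρ.h w') = (-2 : ℂ) • ρ.Em w' :=
            congrArg (fun A : V →L[ℂ] V => A w') ρ.h_Em
          change ρ.Em (ρ.h w' - (2 : ℂ) • w') = ρ.h (ρ.Em w')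
          rw [map_sub, map_smul, sub_eq_iff_eq_add.1 h1]
          module
        · have h2 : Commute (c • ρ.K (-1) - z • (1 : V →L[ℂ] V)) ρ.h :=
            ((ρ.commute_h_K _).symm.smul_left _).sub_left ((Commute.one_left _).smul_left _)
          have h3 : (c • ρ.K (-1) - z • (1 : V →L[ℂ] V)) (ρ.Em w') = 0 := hw
          have h4 := congrArg (fun A : V →L[ℂ] V => A (ρ.Em w')) h2.eq
          have h5 : (c • ρ.K (-1) - z • (1 : V →L[ℂ] V)) (ρ.h (ρ.Em w'))
            = ρ.h ((c • ρ.K (-1) - z • (1 : V →L[ℂ] V)) (ρ.Em w')) := h4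
          rw [h3, map_zero] at h5
          exact h5
      obtain ⟨w, ⟨hwr, hwk⟩, hw0, μ, hμ⟩ :=
        exists_eigenvector_mem ρ.h hE (v := v) ⟨hv, sub_eq_zero.2 hz⟩ hv0
      have h2 := hlarge μ (hasEigenvalue_of_apply_eq hμ hw0) (ρ.hasEigenvalue_add_two hwr hw0 hμ)
      have h3 : c • ρ.K (-1) w = z • w := sub_eq_zero.1 hwk
      rw [ρ.K_apply hμ, smul_smul] at h3
      have h4 : z = (x * cpow ℏ (μ + 1))⁻¹ := by
        rw [← smul_left_injective ℂ hw0 h3, cpow_add, mul_inv, mul_inv, ← cpow_neg, ← cpow_neg]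
        simp only [c, neg_mul, one_mul]
        ring
      rw [h4, norm_inv]
      exact inv_lt_one_of_one_lt₀ h2
  have h2 : Function.Injective fun k : ℕ => 2 * k + 1 := fun a b h => by simpa using h
  refine Summable.of_nonneg_of_le (fun _ => norm_nonneg _) (fun k => ?_)
    ((h1.comp_injective h2).mul_left ‖cpow ℏ (-1) • ρ.K (-1 / 2)‖)
  have h3 : ρ.NminusArg x k
      = cpow ℏ (-1) • ρ.K (-1 / 2) * ((c • ρ.K (-1)) ^ (2 * k + 1) * ρ.Em) := by
    rw [NminusArg_eq, smul_pow, K_pow, smul_mul_assoc, smul_mul_assoc, mul_smul_comm, K_mul_assoc,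
      smul_smul]
    congr 1
    · simp only [c]
      rw [mul_pow, inv_pow, ← cpow_nat_mul, mul_left_comm, ← cpow_add]
      congr 2; push_cast; ring
    · congr 2; push_cast; ring
  rw [h3]
  exact norm_mul_le _ _

theorem tendsto_NminusPartial : Tendsto (ρ.NminusPartial x) atTop (𝓝 (ρ.Nminus x)) := by
  have := FiniteDimensional.complete ℂ V
  obtain ⟨d, hd⟩ := ρ.exists_NminusArg_pow_eq_zero x
  have hs := ρ.summable_norm_NminusArg hx hlarge
  have h1 : ∀ k, qExp (-ℏ) (ρ.NminusArg x k) - 1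
      = ∑ n ∈ Finset.range d, qExpTerm (-ℏ) (ρ.NminusArg x k) (n + 1) := by
    intro k
    have : qExp (-ℏ) (ρ.NminusArg x k)
        = ∑ n ∈ Finset.range (d + 1), qExpTerm (-ℏ) (ρ.NminusArg x k) n :=
      tsum_eq_sum fun n hn => by
        rw [qExpTerm, hd k n (by simp at hn; omega), smul_zero]
    rw [this, Finset.sum_range_succ']
    simp [qExpTerm]
  have h2 : Summable fun k => ‖qExp (-ℏ) (ρ.NminusArg x k) - 1‖ := by
    refine Summable.of_nonneg_of_le (fun _ => norm_nonneg _)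
      (fun k => (congrArg norm (h1 k)).trans_le (norm_sum_le _ _)) (summable_sum fun n _ => ?_)
    refine Summable.of_nonneg_of_le (fun _ => norm_nonneg _) (fun k => ?_)
      (hs.mul_left (‖(pFact (-ℏ) (n + 1))⁻¹‖ * (∑' k, ‖ρ.NminusArg x k‖) ^ n))
    rw [qExpTerm, norm_smul, mul_assoc]
    refine mul_le_mul_of_nonneg_left ((norm_pow_le' _ n.succ_pos).trans ?_) (norm_nonneg _)
    rw [pow_succ]
    gcongr
    exact hs.le_tsum k fun _ _ => norm_nonneg _
  refine (cauchySeq_of_norm_sub_le_mul (fun _ => norm_nonneg _) h2 fun k => ?_).tendsto_limUnder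
  have : ρ.NminusPartial x (k + 1) - ρ.NminusPartial x k
      = (qExp (-ℏ) (ρ.NminusArg x k) - 1) * ρ.NminusPartial x k := by
    rw [NminusPartial, sub_mul, one_mul]
  rw [this]
  exact norm_mul_le _ _

end

end Rep

/-! ### Weight strings and invertibility of `(W; Q)_∞`. -/

theorem exists_pow_apply_ne_zero {V : Type*} [NormedAddCommGroup V] [NormedSpace ℂ V]
    {T : V →L[ℂ] V} {d : ℕ} (hT : T ^ d = 0) {v : V} (hv : v ≠ 0) :
    ∃ r : ℕ, (T ^ r) v ≠ 0 ∧ T ((T ^ r) v) = 0 := by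
  by_contra! h
  have h1 : ∀ r : ℕ, (T ^ r) v ≠ 0 := by
    intro r
    induction r with
    | zero => exact hv
    | succ r ih => rw [pow_succ']; exact h r ih
  exact h1 d (by rw [hT]; rfl)

namespace Rep

variable {ℏ : ℂ} {V : Type*} [NormedAddCommGroup V] [NormedSpace ℂ V] [FiniteDimensional ℂ V]
  (ρ : Rep ℏ V)

theorem h_pow_apply {T : V →L[ℂ] V} {w : ℂ} (hT : ρ.h * T - T * ρ.h = w • T) {v : V} {μ : ℂ}
    (hv : ρ.h v = μ • v) (n : ℕ) : ρ.h ((T ^ n) v) = (μ + n * w) • (T ^ n) v := by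
  have h1 : ρ.h ((T ^ n) v) - (T ^ n) (ρ.h v) = (n * w) • (T ^ n) v :=
    congrArg (fun A : V →L[ℂ] V => A v) (ρ.h_mul_pow hT n)
  rw [sub_eq_iff_eq_add.1 h1, hv, map_smul]
  module

theorem opNum_h_apply {v : V} {μ : ℂ} (hv : ρ.h v = μ • v) : opNum ℏ ρ.h v = qNum ℏ μ • v := by
  have h1 : opPow ℏ ρ.h v = cpow ℏ μ • v := by
    simpa [K] using ρ.K_apply hv 1
  have h2 : opPow ℏ (-ρ.h) v = cpow ℏ (-μ) • v := by
    simpa [K] using ρ.K_apply hv (-1)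
  change (cpow ℏ 1 - cpow ℏ (-1))⁻¹ • (opPow ℏ ρ.h v - opPow ℏ (-ρ.h) v) = _
  rw [h1, h2, qNum]
  module

variable (hℏ : ‖cpow ℏ 1‖ < 1)

include hℏ

theorem Em_Ep_pow_apply {w : V} {ν : ℂ} (hw : ρ.h w = ν • w) (hlow : ρ.Em w = 0) (j : ℕ) :
    ρ.Em ((ρ.Ep ^ (j + 1)) w) = -(qNum ℏ (j + 1) * qNum ℏ (ν + j)) • (ρ.Ep ^ j) w := by
  have h1 : ∀ u, ρ.Em (ρ.Ep u) = ρ.Ep (ρ.Em u) - opNum ℏ ρ.h u := by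
    intro u
    have : ρ.Ep (ρ.Em u) - ρ.Em (ρ.Ep u) = opNum ℏ ρ.h u :=
      congrArg (fun A : V →L[ℂ] V => A u) ρ.Ep_Em
    rw [← this]; abel
  have hδ := cpow_one_sub_ne_zero hℏ
  induction j with
  | zero =>
    have h2 : qNum ℏ 1 = 1 := div_self hδ
    change ρ.Em (ρ.Ep w) = _ • w
    rw [h1, hlow, map_zero, ρ.opNum_h_apply hw]
    simp [h2]
  | succ j ih =>
    have h3 : (ρ.Ep ^ (j + 1 + 1)) w = ρ.Ep ((ρ.Ep ^ (j + 1)) w) := by rw [pow_succ' _ (j + 1)]; rfl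
    have h4 : ρ.Ep ((ρ.Ep ^ j) w) = (ρ.Ep ^ (j + 1)) w := by rw [pow_succ']; rfl
    have h5 : qNum ℏ ((j + 1 : ℕ) + 1) * qNum ℏ (ν + (j + 1 : ℕ))
        = qNum ℏ (j + 1) * qNum ℏ (ν + j) + qNum ℏ (ν + (j + 1 : ℕ) * 2) := by
      have hj := cpow_ne_zero ℏ j
      have hν := cpow_ne_zero ℏ ν
      have h1 := cpow_ne_zero ℏ 1
      push_cast
      simp only [qNum, mul_two]
      rw [div_mul_div_comm, div_mul_div_comm]
      simp only [neg_add, cpow_add, cpow_neg] at hδ ⊢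
      have hδ' : cpow ℏ 1 ^ 2 - 1 ≠ 0 := by
        intro h
        apply hδ
        field_simp
        linear_combination h
      field_simp
      ring
    rw [h3, h1, ih, ρ.opNum_h_apply (ρ.h_pow_apply ρ.h_Ep hw (j + 1)), map_smul, h4, h5]
    module

variable {x : ℂ} (hreg : ∀ j : ℕ, 1 ≤ j → x ^ 2 * cpow ℏ (2 * (j : ℂ)) ≠ 1)
    (hlarge : ∀ μ : ℂ, Module.End.HasEigenvalue (ρ.h : V →ₗ[ℂ] V) μ →
      Module.End.HasEigenvalue (ρ.h : V →ₗ[ℂ] V) (μ + 2) →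
      1 < ‖x * cpow ℏ (μ + 1)‖)

include hreg hlarge

/-- Descend `t` steps from `v` to a vector `w` killed by `E_-`, of weight `ν = μ - 2t`, then climb
`r` steps to the top of its string. Applying `E_-` to `E_+^(r+1) w = 0` forces `[ν + r]_q = 0`, that
is `q^(2(ν+r)) = 1`, so the product in question is `x² q^(2(1+i+2t-r))`. -/
theorem one_sub_ne_zero_of_hasEigenvalue {v : V} {μ : ℂ} (hv : ρ.h v = μ • v) (hv0 : v ≠ 0)
    (i : ℕ) : 1 - cpow ℏ 2 * x ^ 2 * cpow ℏ (2 * μ) * cpow ℏ 2 ^ i ≠ 0 := by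
  obtain ⟨d₁, hd₁⟩ := ρ.exists_Em_pow_eq_zero
  obtain ⟨d₂, hd₂⟩ := ρ.exists_Ep_pow_eq_zero
  obtain ⟨t, ht0, ht⟩ := exists_pow_apply_ne_zero (hd₁ d₁ le_rfl) hv0
  obtain ⟨r, hr0, hr⟩ := exists_pow_apply_ne_zero (hd₂ d₂ le_rfl) ht0
  have hw := ρ.h_pow_apply ρ.h_Em hv t
  generalize (ρ.Em ^ t) v = w at *
  have h1 := ρ.Em_Ep_pow_apply hℏ hw ht r
  have h2 : (ρ.Ep ^ (r + 1)) w = 0 := by rw [pow_succ']; exact hr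
  rw [h2, map_zero, eq_comm, smul_eq_zero, or_iff_left hr0, neg_eq_zero, mul_eq_zero,
    or_iff_right (qNum_nat_ne_zero hℏ r), qNum_eq_zero_iff hℏ] at h1
  have h3 : cpow ℏ (2 * μ) = cpow ℏ (2 * (2 * t - r)) := by
    have : cpow ℏ (2 * μ) = cpow ℏ (2 * (μ + t * -2 + r)) * cpow ℏ (2 * (2 * t - r)) := by
      rw [← cpow_add]; congr 1; ring
    rw [this, h1, one_mul]
  have h4 : cpow ℏ 2 * x ^ 2 * cpow ℏ (2 * μ) * cpow ℏ 2 ^ i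
      = x ^ 2 * cpow ℏ (2 * (1 + i + 2 * t - r)) := by
    have : cpow ℏ (2 * (1 + i + 2 * t - r)) = cpow ℏ 2 * cpow ℏ (2 * (2 * t - r)) * cpow ℏ 2 ^ i := by
      rw [← cpow_nat_mul, ← cpow_add, ← cpow_add]; congr 1; ring
    rw [h3, this]; ring
  rw [h4, sub_ne_zero, ne_comm]
  -- A positive exponent is excluded by `hreg`. A nonpositive one would give `|x| = |q|^s ≤ 1`,
  -- which contradicts `hlarge` at the top of the string.
  rcases le_or_gt (1 + i + 2 * t) r with hle | hlt
  · obtain ⟨s, rfl⟩ := Nat.exists_eq_add_of_le hle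
    intro h5
    have h6 : cpow ℏ (2 * (1 + i + 2 * t - (1 + i + 2 * t + s : ℕ))) = (cpow ℏ 1 ^ s)⁻¹ ^ 2 := by
      rw [← cpow_nat, ← cpow_neg, ← cpow_nat_mul]; congr 1; push_cast; ring
    rw [h6, ← mul_pow] at h5
    have h7 : ‖x * (cpow ℏ 1 ^ s)⁻¹‖ = 1 := by
      have := congrArg norm h5
      rw [norm_pow, norm_one] at this
      exact (pow_eq_one_iff_of_nonneg (norm_nonneg _) two_ne_zero).1 this
    have h8 : ‖x‖ ≤ 1 := by
      rw [norm_mul, norm_inv, norm_pow, ← div_eq_mul_inv, div_eq_one_iff_eq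
        (pow_ne_zero _ (norm_ne_zero_iff.2 (cpow_ne_zero _ _)))] at h7
      rw [h7]
      exact pow_le_one₀ (norm_nonneg _) hℏ.le
    obtain ⟨r', hr'⟩ : ∃ r', 1 + i + 2 * t + s = r' + 1 := ⟨i + 2 * t + s, by ring⟩
    rw [hr'] at hr0 h1
    have h9 : (ρ.Ep ^ r') w ≠ 0 := by
      intro h
      apply hr0
      rw [pow_succ']
      change ρ.Ep ((ρ.Ep ^ r') w) = 0
      rw [h, map_zero]
    have e1 := hasEigenvalue_of_apply_eq (ρ.h_pow_apply ρ.h_Ep hw r') h9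
    have e2 := hasEigenvalue_of_apply_eq (ρ.h_pow_apply ρ.h_Ep hw (r' + 1)) hr0
    -- The two highest weights of the string are used. As `|q^(ν+r)| = 1` with `r = r' + 1`, the
    -- norm in `hlarge` equals `|x| |q|^(r')`, which is at most `1`.
    have h10 := hlarge _ e1 (by convert e2 using 1; push_cast; ring)
    have h11 : cpow ℏ (μ + t * -2 + r' * 2 + 1)
        = cpow ℏ (μ + t * -2 + (r' + 1 : ℕ)) * cpow ℏ 1 ^ r' := by
      rw [← cpow_nat, ← cpow_add]; congr 1; push_cast; ring
    have h12 : ‖cpow ℏ (μ + t * -2 + (r' + 1 : ℕ))‖ = 1 := by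
      rw [two_mul, cpow_add, ← sq] at h1
      have := congrArg norm h1
      rw [norm_pow, norm_one] at this
      exact (pow_eq_one_iff_of_nonneg (norm_nonneg _) two_ne_zero).1 this
    rw [h11, norm_mul, norm_mul, h12, one_mul, norm_pow] at h10
    exact h10.not_ge (mul_le_one₀ h8 (by positivity) (pow_le_one₀ (norm_nonneg _) hℏ.le))
  · obtain ⟨s, hs⟩ := Nat.exists_eq_add_of_lt hlt
    have h5 : (1 : ℂ) + i + 2 * t = r + s + 1 := by exact_mod_cast hs
    have h6 := hreg (s + 1) (by omega)
    rw [h5]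
    convert h6 using 4
    push_cast; ring

/-- A nonzero kernel would be `h`-stable and so contain an eigenvector of `h`, on which the product
acts as an invertible scalar Pochhammer operator. -/
theorem isUnit_qPochInf_shiftedArg : IsUnit (qPochInf (cpow ℏ 2) (ρ.shiftedArg x)) := by
  have hQ := norm_cpow_two_lt_one hℏ
  refine isUnit_of_injective fun v hv => ?_
  by_contra hv0
  have hc : Commute ρ.h (qPochInf (cpow ℏ 2) (ρ.shiftedArg x)) :=
    commute_qPochInf hQ ((ρ.commute_h_K 2).smul_right _)
  obtain ⟨w, hw, hw0, μ, hμ⟩ := exists_eigenvector_mem ρ.h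
    (E := LinearMap.ker (qPochInf (cpow ℏ 2) (ρ.shiftedArg x) : V →ₗ[ℂ] V)) (fun u hu => by
      have h1 : qPochInf (cpow ℏ 2) (ρ.shiftedArg x) u = 0 := hu
      have h2 : ρ.h (qPochInf (cpow ℏ 2) (ρ.shiftedArg x) u)
          = qPochInf (cpow ℏ 2) (ρ.shiftedArg x) (ρ.h u) :=
        congrArg (fun A : V →L[ℂ] V => A u) hc.eq
      rw [h1, map_zero] at h2
      exact h2.symm) (v := v) hv hv0
  have h1 : ρ.shiftedArg x w = (cpow ℏ 2 * x ^ 2 * cpow ℏ (2 * μ)) • w := by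
    change (cpow ℏ 2 * x ^ 2) • ρ.K 2 w = _
    rw [ρ.K_apply hμ, smul_smul]
  have h2 : qPochInf (cpow ℏ 2) (ρ.shiftedArg x) w = 0 := hw
  rw [qPochInf_apply hQ h1] at h2
  obtain ⟨U, hU⟩ := isUnit_qPochInf_smul_one (V := V) hQ
    (ρ.one_sub_ne_zero_of_hasEigenvalue hℏ hreg hlarge hμ hw0)
  have h3 : (U⁻¹ : (V →L[ℂ] V)ˣ).val (U.val w) = w :=
    congrArg (fun A : V →L[ℂ] V => A w) U.inv_mul
  rw [hU, h2, map_zero] at h3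
  exact hw0 h3.symm

end Rep

end UqSl2

end

/-! ### Comparison of the two normally ordered forms. -/

theorem mainTheorem3 (ℏ : ℂ) (hℏ : ‖UqSl2.cpow ℏ 1‖ < 1)
    {V : Type*} [NormedAddCommGroup V] [NormedSpace ℂ V] [FiniteDimensional ℂ V]
    (ρ : UqSl2.Rep ℏ V) (x : ℂ) (hx : x ≠ 0)
    (hreg : ∀ j : ℕ, 1 ≤ j → x ^ 2 * UqSl2.cpow ℏ (2 * (j : ℂ)) ≠ 1)
    (hlarge : ∀ μ : ℂ, Module.End.HasEigenvalue (ρ.h : V →ₗ[ℂ] V) μ →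
      Module.End.HasEigenvalue (ρ.h : V →ₗ[ℂ] V) (μ + 2) →
      1 < ‖x * UqSl2.cpow ℏ (μ + 1)‖) :
    -- all series and infinite products that enter converge, and the denominator is invertible
    (Summable (ρ.MTerm x) ∧
      Summable (UqSl2.qExpTerm (-ℏ) (-x • ρ.e)) ∧
      (∀ k : ℕ, Summable (UqSl2.qExpTerm (-ℏ) (ρ.NminusArg x k))) ∧
      Tendsto (ρ.NminusPartial x) atTop (𝓝 (ρ.Nminus x)) ∧
      Tendsto (UqSl2.qPochPartial (UqSl2.cpow ℏ 2)
          ((UqSl2.cpow ℏ 2 * x ^ 2) • (1 : V →L[ℂ] V))) atTop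
        (𝓝 (UqSl2.qPochInf (UqSl2.cpow ℏ 2)
          ((UqSl2.cpow ℏ 2 * x ^ 2) • (1 : V →L[ℂ] V)))) ∧
      Tendsto (UqSl2.qPochPartial (UqSl2.cpow ℏ 2) (ρ.shiftedArg x)) atTop
        (𝓝 (UqSl2.qPochInf (UqSl2.cpow ℏ 2) (ρ.shiftedArg x))) ∧
      IsUnit (UqSl2.qPochInf (UqSl2.cpow ℏ 2) (ρ.shiftedArg x))) ∧
    -- the relation between the two solutions
    ρ.N x = ρ.dynFactor x * ρ.M x := by
  have := FiniteDimensional.complete ℂ V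
  have hQ := UqSl2.norm_cpow_two_lt_one hℏ
  have hC : ∀ i : ℕ, 1 - UqSl2.cpow ℏ 2 * x ^ 2 * UqSl2.cpow ℏ 2 ^ i ≠ 0 := by
    intro i h
    refine hreg (i + 1) (by omega) ?_
    rw [sub_eq_zero.1 h, mul_comm 2, UqSl2.cpow_nat_mul, pow_succ]
    ring
  have hN := ρ.tendsto_NminusPartial hx hlarge
  have hX : Tendsto (ρ.NminusArg x) atTop (𝓝 0) :=
    (ρ.summable_norm_NminusArg hx hlarge).of_norm.tendsto_atTop_zero
  have hU := ρ.isUnit_qPochInf_shiftedArg hℏ hreg hlarge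
  obtain ⟨d, hd⟩ := ρ.exists_Ep_pow_eq_zero
  obtain ⟨d', hd'⟩ := ρ.exists_NminusArg_pow_eq_zero x
  have hM : Summable (ρ.MTerm x) := (ρ.hasSum_MTerm hℏ hx hC).summable
  refine ⟨⟨hM, ?_, fun k => ?_, hN,
    UqSl2.tendsto_qPochPartial hQ _, UqSl2.tendsto_qPochPartial hQ _, hU⟩, ?_⟩
  · refine Summable.of_norm (f := UqSl2.qExpTerm (-ℏ) (-x • ρ.e))
      (UqSl2.summable_norm_of_eq_zero (d := d) fun n hn => ?_)
    rw [UqSl2.qExpTerm, UqSl2.Rep.e, ← UqSl2.Rep.K, smul_pow, UqSl2.Rep.K_mul_Ep_pow, hd n hn]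
    simp
  · refine Summable.of_norm (f := UqSl2.qExpTerm (-ℏ) (ρ.NminusArg x k))
      (UqSl2.summable_norm_of_eq_zero (d := d') fun n hn => ?_)
    rw [UqSl2.qExpTerm, hd' k n hn, smul_zero]
  · have h1 := (ρ.qPochInf_mul_N hℏ hx hX hN).trans (ρ.qPochInf_mul_M hℏ hx hC).symm
    -- The scalar product commutes with every operator, so the inverse can be brought to the far
    -- left and cancelled there.
    have h2 : Commute (Ring.inverse (UqSl2.qPochInf (UqSl2.cpow ℏ 2) (ρ.shiftedArg x)))
        (UqSl2.qPochInf (UqSl2.cpow ℏ 2) ((UqSl2.cpow ℏ 2 * x ^ 2) • (1 : V →L[ℂ] V))) :=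
      UqSl2.commute_qPochInf hQ ((Commute.one_right _).smul_right _)
    rw [UqSl2.Rep.dynFactor, ← h2.eq, mul_assoc, ← h1, ← mul_assoc,
      Ring.inverse_mul_cancel _ hU, one_mul]
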